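/- Fix a critical exponent $\alpha>1$. **Lorenz maps.** For $c\in(0,1)$ and $u,v\in[0,1]$ let $q(x)=u\bigl(1-(\tfrac{c-x}{c})^\alpha\bigr)$ for $x\in[0,c)$ and $q(x)=1+v\bigl(-1+(\tfrac{x-c}{1-c})^\alpha\bigr)$ for $x\in(c,1]$. A Lorenz map is a map $f:[0,1]\setminus\{c\}\to[0,1]$ with $f=\phi_-\circ q$ on $[0,c)$ and $f=\phi_+\circ q$ on $(c,1]$, where the diffeomorphic parts $\phi_\pm$ are increasing $C^3$-diffeomorphisms of $[0,1]$ with nonpositive Schwarzian derivative, $f_+(c)\le c\le f_-(c)$ for the one-sided limits $f_-(c)=\phi_-(u)$, $f_+(c)=\phi_+(1-v)$, and the only fixed points are $0$ and $1$. It is nontrivial if $f_+(c)<c<f_-(c)$; a branch with $f_\pm(c)=c$ is called trivial. It is $\epsilon$-close to standard maps if both $\phi_\pm$ have $C^2$-distance at most $\epsilon$ to the identity. **Renormalization.** A return interval of $f$ is a closed interval $C\subsetneq[0,1]$, with $c$ in its interior, such that the first-return map to $C$, affinely rescaled to $[0,1]$, is a Lorenz map. Let $C$ be the largest one, $C^-=C\cap[0,c)$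 and $C^+=C\cap(c,1]$. For integers $a,b\ge1$ the return is of monotone type $(a,b)$ if the points of $C^-$ first return at time $a+1$ and are to the right of $c$ at times $1,\dots,a$, and the points of $C^+$ first return at time $b+1$ and are to the left of $c$ at times $1,\dots,b$. The rescaled return map is then the renormalization $\mathcal Rf$; its diffeomorphic parts are the affine rescalings to $[0,1]$ of the monotone branches of $f_+^a\circ\phi_-$ and $f_-^b\circ\phi_+$ onto $C$ (from the subintervals of $[0,1]$ which they map onto $C$). The map $f$ is $(a,b)$-renormalizable if moreover $\mathcal Rf$ is nontrivial. The gaps $G^-$ and $G^+$ are the connected components, adjacent to $C$ at the left and at the right, of the complement in $[0,1]$ of the union of the intervals $\overline{f^k(C^-)}$, $0\le k\le a$, and $\overline{f^k(C^+)}$, $0\le k\le b$. **Families.** A family is a map $\lambda\mapsto F_\lambda$ to Lorenz maps, defined on a compact simply connected $U\subset\mathbb R^2$, such that $c,u,v$ and $\phi_\pm\in C^2([0,1])$ depend continuously on $\lambda$ and $F_\lambda$ is nontrivial for $\lambda$ in the interior of $U$. It is analytic if these dependences are real-analytic, and full if for every nontrivial Lorenz map $g$ some $F_\lambda$ has the same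 kneading invariants as $g$ (the same left/right itineraries of $c^-$ and of $c^+$). The archipelago $A_{a,b}$ is the set of $\lambda\in U$ for which $F_\lambda$ is $(a,b)$-renormalizable. An island is the closure of a connected component of the interior of $A_{a,b}$. A full island $D_{a,b}$ is an island on which every $F_\lambda$ has a renormalization of monotone type $(a,b)$ (possibly with trivial branches on the boundary) and on which $\lambda\mapsto\mathcal RF_\lambda$ is a full family. **Statement.** There is $\delta>0$, depending only on $\alpha$, such that the following holds for every analytic full family $F$ all of whose maps are $\delta$-close to standard maps. For every $\epsilon>0$ there exists $N\ge1$ such that, if $a,b\ge N$ and $D_{a,b}$ is a full island of $A_{a,b}$, then for every map $f=F_\lambda$ with $\lambda\in D_{a,b}$ both gaps $G^\pm$ have positive length, $$\max\left\{\frac{|C|}{|G^-|},\frac{|C|}{|G^+|}\right\}\le\epsilon ,$$ and $\mathcal Rf$ is $\epsilon$-close to standard maps. -/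

import Mathlib

open Set Filter Topology MeasureTheory

noncomputable section

/-- The Schwarzian derivative `φ''' / φ' - (3/2) (φ'' / φ')²` of a map of `[0,1]`
(one-sided derivatives at the endpoints). -/
def schwarzianOn (φ : ℝ → ℝ) (x : ℝ) : ℝ :=
  iteratedDerivWithin 3 φ (Icc 0 1) x / derivWithin φ (Icc 0 1) x
    - 3 / 2 * (iteratedDerivWithin 2 φ (Icc 0 1) x / derivWithin φ (Icc 0 1) x) ^ 2

/-- Increasing `C³`-diffeomorphisms of `[0,1]` with nonpositive Schwarzian derivative
(the identity is allowed). Values outside `[0,1]` are irrelevant. -/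
structure LorenzDiffeo where
  toFun : ℝ → ℝ
  map_zero : toFun 0 = 0
  map_one : toFun 1 = 1
  contDiffOn : ContDiffOn ℝ 3 toFun (Icc 0 1)
  deriv_pos : ∀ x ∈ Icc (0 : ℝ) 1, 0 < derivWithin toFun (Icc 0 1) x
  schwarzian_nonpos : ∀ x ∈ Icc (0 : ℝ) 1, schwarzianOn toFun x ≤ 0

/-- The `k`-th derivative, `k ≤ 2`, as an element of the Banach space `C([0,1])`. The three
of them together are the image of the diffeomorphism in the Banach space `C²([0,1])`. -/
def LorenzDiffeo.jet (φ : LorenzDiffeo) (k : Fin 3) : C(Icc (0 : ℝ) 1, ℝ) where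
  toFun x := iteratedDerivWithin k φ.toFun (Icc 0 1) x
  continuous_toFun := by
    have h := φ.contDiffOn.continuousOn_iteratedDerivWithin (m := (k : ℕ))
      (by exact_mod_cast (show (k : ℕ) ≤ 3 by omega)) (uniqueDiffOn_Icc zero_lt_one)
    exact continuousOn_iff_continuous_domRestrict.mp h

/-- The `C²`-distance to the identity is at most `ε`. -/
def LorenzDiffeo.CloseToId (φ : LorenzDiffeo) (ε : ℝ) : Prop :=
  ∀ x ∈ Icc (0 : ℝ) 1, |φ.toFun x - x| ≤ ε ∧
    |derivWithin φ.toFun (Icc 0 1) x - 1| ≤ ε ∧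
    |iteratedDerivWithin 2 φ.toFun (Icc 0 1) x| ≤ ε

/-- The standard Lorenz map with critical exponent `α`, critical point `c` and critical values
`u`, `1 - v`. Its value at `x = c` is irrelevant. -/
def standardLorenz (α u v c x : ℝ) : ℝ :=
  if x < c then u * (1 - ((c - x) / c) ^ α) else 1 + v * (-1 + ((x - c) / (1 - c)) ^ α)

/-- A Lorenz map with critical exponent `α`, given by its standard part `(u, v, c)` and its
diffeomorphic parts. The last four fields say that `f₊(c) ≤ c ≤ f₋(c)`, i.e. each branch is
trivial or has the critical point in the interior of its image, and that
`0`, `1` are the only fixed points. -/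
structure LorenzMap (α : ℝ) where
  c : ℝ
  u : ℝ
  v : ℝ
  phiMinus : LorenzDiffeo
  phiPlus : LorenzDiffeo
  c_mem : c ∈ Ioo (0 : ℝ) 1
  u_mem : u ∈ Icc (0 : ℝ) 1
  v_mem : v ∈ Icc (0 : ℝ) 1
  le_critMinus : c ≤ phiMinus.toFun u
  critPlus_le : phiPlus.toFun (1 - v) ≤ c
  no_fixed_minus : ∀ x ∈ Ioo 0 c, phiMinus.toFun (standardLorenz α u v c x) ≠ x
  no_fixed_plus : ∀ x ∈ Ioo c 1, phiPlus.toFun (standardLorenz α u v c x) ≠ x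

namespace LorenzMap

variable {α : ℝ}

/-- The standard part `q` of a Lorenz map. -/
def std (f : LorenzMap α) (x : ℝ) : ℝ := standardLorenz α f.u f.v f.c x

/-- The map `f : [0,1] \ {c} → [0,1]` itself; its value at `c` is irrelevant. -/
def map (f : LorenzMap α) (x : ℝ) : ℝ :=
  if x < f.c then f.phiMinus.toFun (f.std x) else f.phiPlus.toFun (f.std x)

/-- Both branches have the critical point in the interior of their image: `f₊(c) < c < f₋(c)`,
where `f₋(c) = φ₋(u)` and `f₊(c) = φ₊(1 - v)` are the one-sided limits at `c`. -/
def IsNontrivial (f : LorenzMap α) : Prop :=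
  f.phiPlus.toFun (1 - f.v) < f.c ∧ f.c < f.phiMinus.toFun f.u

/-- `f` is `ε`-close to standard maps. -/
def CloseToStandard (f : LorenzMap α) (ε : ℝ) : Prop :=
  f.phiMinus.CloseToId ε ∧ f.phiPlus.CloseToId ε

/-- The `n`-th symbol of the itinerary of `c⁻` is `L` (otherwise it is `R`). -/
def kneadingMinusIsL (f : LorenzMap α) (n : ℕ) : Prop :=
  ∀ᶠ x in 𝓝[<] f.c, f.map^[n] x < f.c

/-- The `n`-th symbol of the itinerary of `c⁺` is `L` (otherwise it is `R`). -/
def kneadingPlusIsL (f : LorenzMap α) (n : ℕ) : Prop :=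
  ∀ᶠ x in 𝓝[>] f.c, f.map^[n] x < f.c

/-- Two Lorenz maps have the same combinatorics: the same kneading invariants. -/
def SameCombinatorics (f g : LorenzMap α) : Prop :=
  ∀ n : ℕ, (f.kneadingMinusIsL n ↔ g.kneadingMinusIsL n) ∧
    (f.kneadingPlusIsL n ↔ g.kneadingPlusIsL n)

/-- `n` is the first-return time of `x` to `[p,q]`. -/
def IsFirstReturnTime (f : LorenzMap α) (p q x : ℝ) (n : ℕ) : Prop :=
  1 ≤ n ∧ f.map^[n] x ∈ Icc p q ∧ ∀ k, 1 ≤ k → k < n → f.map^[k] x ∉ Icc p q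

/-- The first-return map of `f` to `[p,q] \ {c}`, affinely rescaled to `[0,1]`, is the Lorenz
map `g`. -/
def IsReturnMap (f : LorenzMap α) (p q : ℝ) (g : LorenzMap α) : Prop :=
  f.c = p + (q - p) * g.c ∧
  ∀ x ∈ Icc (0 : ℝ) 1, x ≠ g.c → ∃ n, f.IsFirstReturnTime p q (p + (q - p) * x) n ∧
    f.map^[n] (p + (q - p) * x) = p + (q - p) * g.map x

/-- `[p,q]` is a proper subinterval of `[0,1]` with `c` in its interior, and the first-return
map to it is a Lorenz map. -/
def IsReturnInterval (f : LorenzMap α) (p q : ℝ) : Prop :=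
  0 ≤ p ∧ p < f.c ∧ f.c < q ∧ q ≤ 1 ∧ Icc p q ≠ Icc 0 1 ∧ ∃ g : LorenzMap α, f.IsReturnMap p q g

/-- `[p,q]` is the largest return interval. -/
def IsLargestReturnInterval (f : LorenzMap α) (p q : ℝ) : Prop :=
  f.IsReturnInterval p q ∧ ∀ p' q', f.IsReturnInterval p' q' → Icc p' q' ⊆ Icc p q

/-- The return to `C = [p,q]` is of monotone type `(a,b)`: `C⁻ = [p,c)` returns at time `a + 1`
and is to the right of `c` in between, `C⁺ = (c,q]` returns at time `b + 1` and is to the left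
of `c` in between. -/
def IsMonotoneType (f : LorenzMap α) (a b : ℕ) (p q : ℝ) : Prop :=
  1 ≤ a ∧ 1 ≤ b ∧
  (∀ x ∈ Ico p f.c, f.IsFirstReturnTime p q x (a + 1) ∧
    ∀ k, 1 ≤ k → k ≤ a → f.c < f.map^[k] x) ∧
  (∀ x ∈ Ioc f.c q, f.IsFirstReturnTime p q x (b + 1) ∧
    ∀ k, 1 ≤ k → k ≤ b → f.map^[k] x < f.c)

/-- `f` is `(a,b)`-renormalizable: the first-return map to the largest return interval is a
nontrivial Lorenz map and the return is of monotone type `(a,b)`. -/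
def IsRenormalizable (f : LorenzMap α) (a b : ℕ) : Prop :=
  ∃ p q, f.IsLargestReturnInterval p q ∧ f.IsMonotoneType a b p q ∧
    ∃ g : LorenzMap α, g.IsNontrivial ∧ f.IsReturnMap p q g

/-- The diffeomorphic parts of the Lorenz map `g`, the rescaled return map to `C = [p,q]`:
`g.phiMinus` is the rescaling of `f₊ᵃ ∘ φ₋ : [s,t] → C`, where `[s,t]` is the interval which this
monotone branch maps onto `C`, and the standard part of `g` left of its critical point is the
rescaling of `q : C⁻ → [s,t]`; similarly on the right with `f₋ᵇ ∘ φ₊`. -/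
def HasInducedParts (f : LorenzMap α) (a b : ℕ) (p q : ℝ) (g : LorenzMap α) : Prop :=
  (∃ s t, 0 ≤ s ∧ s < t ∧ t ≤ 1 ∧
    (∀ y ∈ Icc (0 : ℝ) 1,
      (∀ k < a, f.c < f.map^[k] (f.phiMinus.toFun (s + (t - s) * y))) ∧
      f.map^[a] (f.phiMinus.toFun (s + (t - s) * y)) = p + (q - p) * g.phiMinus.toFun y) ∧
    ∀ x ∈ Ico 0 g.c, f.std (p + (q - p) * x) = s + (t - s) * g.std x) ∧
  (∃ s t, 0 ≤ s ∧ s < t ∧ t ≤ 1 ∧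
    (∀ y ∈ Icc (0 : ℝ) 1,
      (∀ k < b, f.map^[k] (f.phiPlus.toFun (s + (t - s) * y)) < f.c) ∧
      f.map^[b] (f.phiPlus.toFun (s + (t - s) * y)) = p + (q - p) * g.phiPlus.toFun y) ∧
    ∀ x ∈ Ioc g.c 1, f.std (p + (q - p) * x) = s + (t - s) * g.std x)

/-- `g`, with its diffeomorphic parts, is the renormalization of `f`, of monotone type `(a,b)` and
with return interval `[p,q]`. Branches of `g` are allowed to be trivial. -/
def IsRenormalization (f : LorenzMap α) (a b : ℕ) (p q : ℝ) (g : LorenzMap α) : Prop :=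
  f.IsLargestReturnInterval p q ∧ f.IsMonotoneType a b p q ∧ f.IsReturnMap p q g ∧
    f.HasInducedParts a b p q g

/-- The union of the cycles of closed intervals `closure (fᵏ(C⁻))`, `0 ≤ k ≤ a`, and
`closure (fᵏ(C⁺))`, `0 ≤ k ≤ b`. -/
def cycles (f : LorenzMap α) (a b : ℕ) (p q : ℝ) : Set ℝ :=
  (⋃ k ∈ Finset.range (a + 1), closure (f.map^[k] '' Ico p f.c)) ∪
  (⋃ k ∈ Finset.range (b + 1), closure (f.map^[k] '' Ioc f.c q))

/-- The gap to the left of `C = [p,q]`: the connected component of the complement of the cycles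
in `[0,1]` which is adjacent to `p` (empty if there is none). -/
def leftGap (f : LorenzMap α) (a b : ℕ) (p q : ℝ) : Set ℝ :=
  {x | 0 ≤ x ∧ x < p ∧ ∀ y ∈ Ico x p, y ∉ f.cycles a b p q}

/-- The gap to the right of `C = [p,q]`. -/
def rightGap (f : LorenzMap α) (a b : ℕ) (p q : ℝ) : Set ℝ :=
  {x | q < x ∧ x ≤ 1 ∧ ∀ y ∈ Ioc q x, y ∉ f.cycles a b p q}

/-- A family of Lorenz maps over a compact and simply connected parameter set, continuous for the
`C²`-topology. Trivial branches are allowed on the boundary only. -/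
structure IsFamily (U : Set (ℝ × ℝ)) (F : ℝ × ℝ → LorenzMap α) : Prop where
  compact : IsCompact U
  simplyConnected : SimplyConnectedSpace U
  nontrivial : ∀ l ∈ interior U, (F l).IsNontrivial
  continuous_c : ContinuousOn (fun l => (F l).c) U
  continuous_u : ContinuousOn (fun l => (F l).u) U
  continuous_v : ContinuousOn (fun l => (F l).v) U
  continuous_phiMinus : ∀ k, ContinuousOn (fun l => (F l).phiMinus.jet k) U
  continuous_phiPlus : ∀ k, ContinuousOn (fun l => (F l).phiPlus.jet k) U

/-- A full family: it realizes the combinatorics of every nontrivial Lorenz map. -/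
def IsFullFamily (U : Set (ℝ × ℝ)) (F : ℝ × ℝ → LorenzMap α) : Prop :=
  IsFamily U F ∧ ∀ g : LorenzMap α, g.IsNontrivial → ∃ l ∈ U, (F l).SameCombinatorics g

/-- The family depends real-analytically on the parameter: the critical point and `u`, `v` do, and
so do the diffeomorphic parts as elements of `C²([0,1])`. -/
structure IsAnalyticFamily (U : Set (ℝ × ℝ)) (F : ℝ × ℝ → LorenzMap α) : Prop where
  analytic_c : AnalyticOn ℝ (fun l => (F l).c) U
  analytic_u : AnalyticOn ℝ (fun l => (F l).u) U
  analytic_v : AnalyticOn ℝ (fun l => (F l).v) U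
  analytic_phiMinus : ∀ k, AnalyticOn ℝ (fun l => (F l).phiMinus.jet k) U
  analytic_phiPlus : ∀ k, AnalyticOn ℝ (fun l => (F l).phiPlus.jet k) U

/-- The `(a,b)`-archipelago. -/
def archipelago (U : Set (ℝ × ℝ)) (F : ℝ × ℝ → LorenzMap α) (a b : ℕ) : Set (ℝ × ℝ) :=
  {l | l ∈ U ∧ (F l).IsRenormalizable a b}

/-- An `(a,b)`-island: the closure of a connected component of the interior of the archipelago. -/
def IsIsland (U : Set (ℝ × ℝ)) (F : ℝ × ℝ → LorenzMap α) (a b : ℕ) (D : Set (ℝ × ℝ)) : Prop :=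
  ∃ l ∈ interior (archipelago U F a b),
    D = closure (connectedComponentIn (interior (archipelago U F a b)) l)

/-- A full `(a,b)`-island: every map in it has a renormalization of type `(a,b)` (which may have
trivial branches on the boundary of the island), and the renormalizations form a full family. -/
def IsFullIsland (U : Set (ℝ × ℝ)) (F : ℝ × ℝ → LorenzMap α) (a b : ℕ) (D : Set (ℝ × ℝ)) :
    Prop :=
  IsIsland U F a b D ∧ ∃ R : ℝ × ℝ → LorenzMap α,
    (∀ l ∈ D, ∃ p q, (F l).IsRenormalization a b p q (R l)) ∧ IsFullFamily D R

end LorenzMap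

end

/-!
On the right of `c` the nonlinearity of `f` at `x` is that of `φ₊`, transported by the standard
map, plus `(α - 1) / (x - c)`. For `δ = (α - 1) / (2 α)` the second term dominates the first. Hence
the branch is convex, so it expands away from its fixed point `1`, and its nonlinearity is at most
`2 (α - 1) / (x - c)`, so its distortion is bounded outside of each
neighbourhood of `c`.

The critical values keep a definite distance from `c`: since an orbit of the return interval passes
at least twice through the right of `c`, and at least twice through the left, the distances `w`
and `w'` of the two critical values to `c` satisfy `w ≤ 2 (w' / c₀)^α` and `w' ≤ 2 (w / c₀)^α`,
which bounds both from below because `α > 1`. Therefore the long passages near the fixed points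
expand uniformly, stay away from `c` and have bounded distortion. They force the return interval
to be exponentially small in `a` and `b` while the gaps stay large, and the diffeomorphic parts of
the return map, restrictions to tiny intervals of maps with bounded distortion, are almost affine.

Only the right branch needs to be studied: the reflection `x ↦ 1 - x` exchanges the two branches.
-/

theorem abs_sub_le_of_abs_deriv_le {f f' g g' : ℝ → ℝ} {D : Set ℝ} (hD : Convex ℝ D)
    (hf : ∀ x ∈ D, HasDerivWithinAt f (f' x) D x) (hg : ∀ x ∈ D, HasDerivWithinAt g (g' x) D x)
    (hfg : ∀ x ∈ D, |f' x| ≤ g' x) {x y : ℝ} (hx : x ∈ D) (hy : y ∈ D) (hxy : x ≤ y) :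
    |f y - f x| ≤ g y - g x := by
  have hmono {h h' : ℝ → ℝ} (hh : ∀ z ∈ D, HasDerivWithinAt h (h' z) D z)
      (hnonneg : ∀ z ∈ D, 0 ≤ h' z) : h x ≤ h y :=
    monotoneOn_of_hasDerivWithinAt_nonneg hD (fun z hz => (hh z hz).continuousWithinAt)
      (fun z hz => (hh z (interior_subset hz)).mono interior_subset)
      (fun z hz => hnonneg z (interior_subset hz)) hx hy hxy
  have hsub := hmono (fun z hz => (hg z hz).sub (hf z hz))
    fun z hz => sub_nonneg.2 (abs_le.1 (hfg z hz)).2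
  have hadd := hmono (fun z hz => (hg z hz).add (hf z hz))
    fun z hz => neg_le_iff_add_nonneg'.1 (abs_le.1 (hfg z hz)).1
  simp only [Pi.sub_apply, Pi.add_apply] at hsub hadd
  exact abs_le.2 ⟨by linarith, by linarith⟩

/-- On `s`, the function `f` has the positive derivative `D`, whose logarithm has the derivative
`N`. Thus `N = f'' / f'` is the nonlinearity of `f`; it measures the distortion of `f`. -/
structure HasNonlinearityOn (f D N : ℝ → ℝ) (s : Set ℝ) : Prop where
  hasDerivWithinAt : ∀ x ∈ s, HasDerivWithinAt f (D x) s x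
  deriv_pos : ∀ x ∈ s, 0 < D x
  hasDerivWithinAt_log : ∀ x ∈ s, HasDerivWithinAt (fun y => Real.log (D y)) (N x) s x

namespace HasNonlinearityOn

variable {f g D E M N : ℝ → ℝ} {s t : Set ℝ}

theorem comp (hg : HasNonlinearityOn g E M t) (hf : HasNonlinearityOn f D N s)
    (hst : MapsTo f s t) :
    HasNonlinearityOn (g ∘ f) (fun x => E (f x) * D x) (fun x => M (f x) * D x + N x) s where
  hasDerivWithinAt x hx :=
    (hg.hasDerivWithinAt _ (hst hx)).comp x (hf.hasDerivWithinAt x hx) hst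
  deriv_pos x hx := mul_pos (hg.deriv_pos _ (hst hx)) (hf.deriv_pos x hx)
  hasDerivWithinAt_log x hx := by
    have hlog : ∀ y ∈ s, Real.log (E (f y) * D y) = Real.log (E (f y)) + Real.log (D y) :=
      fun y hy => Real.log_mul (hg.deriv_pos _ (hst hy)).ne' (hf.deriv_pos y hy).ne'
    exact (((hg.hasDerivWithinAt_log _ (hst hx)).comp x (hf.hasDerivWithinAt x hx) hst).add
      (hf.hasDerivWithinAt_log x hx)).congr hlog (hlog x hx)

theorem affine (b : ℝ) {k : ℝ} (hk : 0 < k) (s : Set ℝ) :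
    HasNonlinearityOn (fun x => b + k * x) (fun _ => k) 0 s where
  hasDerivWithinAt x _ := by
    simpa using ((hasDerivWithinAt_id x s).const_mul k).const_add b
  deriv_pos _ _ := hk
  hasDerivWithinAt_log x _ := hasDerivWithinAt_const x s _

theorem rpow {a : ℝ} (ha : 0 < a) :
    HasNonlinearityOn (fun x => x ^ a) (fun x => a * x ^ (a - 1)) (fun x => (a - 1) / x)
      (Ioi 0) where
  hasDerivWithinAt x hx := (Real.hasDerivAt_rpow_const (Or.inl (ne_of_gt hx))).hasDerivWithinAt
  deriv_pos x hx := mul_pos ha (Real.rpow_pos_of_pos hx _)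
  hasDerivWithinAt_log x hx := by
    have hlog : ∀ y ∈ Ioi (0 : ℝ),
        Real.log (a * y ^ (a - 1)) = Real.log a + (a - 1) * Real.log y := fun y hy => by
      rw [Real.log_mul ha.ne' (Real.rpow_pos_of_pos hy _).ne', Real.log_rpow hy]
    exact (((Real.hasDerivAt_log (ne_of_gt hx)).const_mul (a - 1)).const_add
      (Real.log a)).hasDerivWithinAt.congr hlog (hlog x hx)

theorem eqOn (hf : HasNonlinearityOn f D N s) (hg : HasNonlinearityOn g E M s)
    (hs : UniqueDiffOn ℝ s) (hfg : EqOn f g s) : EqOn D E s ∧ EqOn N M s := by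
  have hDE : EqOn D E s := fun x hx =>
    (hs x hx).eq_deriv s (hf.hasDerivWithinAt x hx)
      ((hg.hasDerivWithinAt x hx).congr hfg (hfg hx))
  have hlog : EqOn (fun y => Real.log (D y)) (fun y => Real.log (E y)) s :=
    fun y hy => congrArg Real.log (hDE hy)
  exact ⟨hDE, fun x hx => (hs x hx).eq_deriv s (hf.hasDerivWithinAt_log x hx)
    ((hg.hasDerivWithinAt_log x hx).congr hlog (hlog hx))⟩

theorem congr (hf : HasNonlinearityOn f D N s) (hfg : EqOn g f s) (hDE : EqOn E D s)
    (hMN : EqOn M N s) : HasNonlinearityOn g E M s where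
  hasDerivWithinAt x hx := hDE hx ▸ (hf.hasDerivWithinAt x hx).congr hfg (hfg hx)
  deriv_pos x hx := hDE hx ▸ hf.deriv_pos x hx
  hasDerivWithinAt_log x hx := by
    have hlog : EqOn (fun y => Real.log (E y)) (fun y => Real.log (D y)) s :=
      fun y hy => congrArg Real.log (hDE hy)
    exact hMN hx ▸ (hf.hasDerivWithinAt_log x hx).congr hlog (hlog hx)

theorem mono (hf : HasNonlinearityOn f D N s) (hts : t ⊆ s) : HasNonlinearityOn f D N t where
  hasDerivWithinAt x hx := (hf.hasDerivWithinAt x (hts hx)).mono hts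
  deriv_pos x hx := hf.deriv_pos x (hts hx)
  hasDerivWithinAt_log x hx := (hf.hasDerivWithinAt_log x (hts hx)).mono hts

theorem iterate_comp {T X : ℝ → ℝ} (hT : HasNonlinearityOn T D N t)
    (hX : HasNonlinearityOn X E M s) (n : ℕ) (hmaps : ∀ k < n, MapsTo (T^[k] ∘ X) s t) :
    HasNonlinearityOn (T^[n] ∘ X)
      (fun y => (∏ j ∈ Finset.range n, D (T^[j] (X y))) * E y)
      (fun y => ∑ j ∈ Finset.range n,
        N (T^[j] (X y)) * ((∏ i ∈ Finset.range j, D (T^[i] (X y))) * E y) + M y) s := by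
  induction n with
  | zero => simpa using hX
  | succ n ih =>
    have hstep := hT.comp (ih fun k hk => hmaps k (hk.trans n.lt_succ_self))
      (hmaps n n.lt_succ_self)
    rw [Function.iterate_succ', Function.comp_assoc]
    convert hstep using 2 with y y
    · rw [Finset.prod_range_succ, Function.comp_apply]
      ring
    · rw [Finset.sum_range_succ, Function.comp_apply]
      ring

theorem deriv_monotoneOn (hf : HasNonlinearityOn f D N s) (hs : Convex ℝ s)
    (hN : ∀ x ∈ s, 0 ≤ N x) : MonotoneOn D s := by
  intro x hx y hy hxy
  rw [← Real.log_le_log_iff (hf.deriv_pos x hx) (hf.deriv_pos y hy)]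
  exact monotoneOn_of_hasDerivWithinAt_nonneg hs
    (fun z hz => (hf.hasDerivWithinAt_log z hz).continuousWithinAt)
    (fun z hz => (hf.hasDerivWithinAt_log z (interior_subset hz)).mono interior_subset)
    (fun z hz => hN z (interior_subset hz)) hx hy hxy

theorem convexOn_Icc {a b : ℝ} (hf : HasNonlinearityOn f D N (Ioc a b))
    (hcont : ContinuousOn f (Icc a b)) (hN : ∀ x ∈ Ioc a b, 0 ≤ N x) :
    ConvexOn ℝ (Icc a b) f := by
  have hderiv : ∀ x ∈ Ioo a b, HasDerivAt f (D x) x := fun x hx =>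
    (hf.hasDerivWithinAt x (Ioo_subset_Ioc_self hx)).hasDerivAt (Ioc_mem_nhds hx.1 hx.2)
  refine MonotoneOn.convexOn_of_deriv (convex_Icc a b) hcont ?_ ?_ <;> rw [interior_Icc]
  · exact fun x hx => (hderiv x hx).differentiableAt.differentiableWithinAt
  · exact ((hf.deriv_monotoneOn (convex_Ioc a b) hN).mono Ioo_subset_Ioc_self).congr
      fun x hx => (hderiv x hx).deriv.symm

theorem deriv_le_exp_mul_deriv (hf : HasNonlinearityOn f D N s) (hs : Convex ℝ s) {L : ℝ}
    (hN : ∀ x ∈ s, |N x| ≤ L) {x y : ℝ} (hx : x ∈ s) (hy : y ∈ s) (hxy : x ≤ y) :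
    D y ≤ Real.exp (L * (y - x)) * D x := by
  have hlog := abs_sub_le_of_abs_deriv_le hs hf.hasDerivWithinAt_log
    (fun z _ => (hasDerivWithinAt_id z s).const_mul L) (by simpa using hN) hx hy hxy
  rw [← Real.exp_log (hf.deriv_pos x hx), ← Real.exp_add, ← Real.exp_log (hf.deriv_pos y hy),
    Real.exp_le_exp]
  simp only [id] at hlog
  linarith [le_abs_self (Real.log (D y) - Real.log (D x))]

end HasNonlinearityOn

theorem le_pow_mul_exp_of_le_mul_exp {P : ℕ → ℝ} {n : ℕ} {r L : ℝ} (hr : 0 ≤ r)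
    (hstep : ∀ j < n, P j ≤ r * Real.exp (L * r ^ (n - j)) * P (j + 1)) {i : ℕ} (hi : i ≤ n) :
    P (n - i) ≤ r ^ i * Real.exp (L * ∑ j ∈ Finset.range i, r ^ (j + 1)) * P n := by
  induction i with
  | zero => simp
  | succ i ih =>
    have h := hstep (n - (i + 1)) (by omega)
    rw [show n - (n - (i + 1)) = i + 1 by omega, show n - (i + 1) + 1 = n - i by omega] at h
    refine h.trans ((mul_le_mul_of_nonneg_left (ih (by omega)) (by positivity)).trans_eq ?_)
    rw [Finset.sum_range_succ, mul_add, Real.exp_add]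
    ring

theorem sum_range_le_of_le_mul_exp {P : ℕ → ℝ} {n : ℕ} {r L : ℝ} (hr0 : 0 < r) (hr1 : r < 1)
    (hL : 0 ≤ L) (hP : 0 ≤ P n)
    (hstep : ∀ j < n, P j ≤ r * Real.exp (L * r ^ (n - j)) * P (j + 1)) :
    ∑ j ∈ Finset.range n, P j ≤ Real.exp (L / (1 - r)) / (1 - r) * P n := by
  have hgeom (k : ℕ) : ∑ i ∈ Finset.range k, r ^ i ≤ 1 / (1 - r) := by
    rw [geom_sum_eq hr1.ne, ← neg_div_neg_eq, neg_sub, neg_sub]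
    have := pow_nonneg hr0.le k
    exact div_le_div_of_nonneg_right (by linarith) (by linarith)
  have hterm : ∀ i ∈ Finset.range n, P (n - 1 - i) ≤ Real.exp (L / (1 - r)) * P n * r ^ i := by
    intro i hi
    have hi := Finset.mem_range.1 hi
    rw [show n - 1 - i = n - (i + 1) by omega]
    calc P (n - (i + 1))
        ≤ r ^ (i + 1) * Real.exp (L * ∑ j ∈ Finset.range (i + 1), r ^ (j + 1)) * P n :=
          le_pow_mul_exp_of_le_mul_exp hr0.le hstep hi
      _ ≤ r ^ i * Real.exp (L * (1 / (1 - r))) * P n := by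
          gcongr ?_ * Real.exp (L * ?_) * _
          · exact pow_le_pow_of_le_one hr0.le hr1.le i.le_succ
          · exact (Finset.sum_le_sum fun j _ =>
              pow_le_pow_of_le_one hr0.le hr1.le j.le_succ).trans (hgeom (i + 1))
      _ = _ := by ring_nf
  rw [← Finset.sum_range_reflect]
  calc ∑ i ∈ Finset.range n, P (n - 1 - i)
      ≤ ∑ i ∈ Finset.range n, Real.exp (L / (1 - r)) * P n * r ^ i := Finset.sum_le_sum hterm
    _ = Real.exp (L / (1 - r)) * P n * ∑ i ∈ Finset.range n, r ^ i := by rw [Finset.mul_sum]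
    _ ≤ Real.exp (L / (1 - r)) * P n * (1 / (1 - r)) := by gcongr; exact hgeom n
    _ = _ := by ring

theorem one_sub_mem_Icc_zero_one {x : ℝ} (hx : x ∈ Icc (0 : ℝ) 1) : 1 - x ∈ Icc (0 : ℝ) 1 :=
  ⟨sub_nonneg.2 hx.2, sub_le_self 1 hx.1⟩

open scoped Pointwise in
theorem iteratedDerivWithin_one_sub_comp_one_sub (φ : ℝ → ℝ) {n : ℕ} (hn : 0 < n) (x : ℝ) :
    iteratedDerivWithin n (fun y => 1 - φ (1 - y)) (Icc 0 1) x =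
      (-1) ^ (n + 1) * iteratedDerivWithin n φ (Icc 0 1) (1 - x) := by
  have hset : (1 : ℝ) +ᵥ -Icc (0 : ℝ) 1 = Icc 0 1 := by
    simp only [neg_Icc, neg_zero, ← image_vadd, vadd_eq_add, image_const_add_Icc,
      add_neg_cancel, add_zero]
  rw [iteratedDerivWithin_const_sub hn, iteratedDerivWithin_fun_neg,
    iteratedDerivWithin_comp_const_sub, hset]
  simp only [smul_eq_mul]
  ring

theorem derivWithin_one_sub_comp_one_sub (φ : ℝ → ℝ) (x : ℝ) :
    derivWithin (fun y => 1 - φ (1 - y)) (Icc 0 1) x = derivWithin φ (Icc 0 1) (1 - x) := by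
  simpa only [iteratedDerivWithin_one, one_add_one_eq_two, even_two.neg_one_pow, one_mul] using
    iteratedDerivWithin_one_sub_comp_one_sub φ one_pos x

theorem schwarzianOn_one_sub_comp_one_sub (φ : ℝ → ℝ) (x : ℝ) :
    schwarzianOn (fun y => 1 - φ (1 - y)) x = schwarzianOn φ (1 - x) := by
  simp only [schwarzianOn, derivWithin_one_sub_comp_one_sub,
    iteratedDerivWithin_one_sub_comp_one_sub _ two_pos,
    iteratedDerivWithin_one_sub_comp_one_sub _ three_pos]
  ring

namespace LorenzDiffeo

variable (φ : LorenzDiffeo) {x y : ℝ} {δ : ℝ}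

theorem hasDerivWithinAt (hx : x ∈ Icc (0 : ℝ) 1) :
    HasDerivWithinAt φ.toFun (derivWithin φ.toFun (Icc 0 1) x) (Icc 0 1) x :=
  (φ.contDiffOn.differentiableOn (by norm_num) x hx).hasDerivWithinAt

theorem hasDerivWithinAt_derivWithin (hx : x ∈ Icc (0 : ℝ) 1) :
    HasDerivWithinAt (derivWithin φ.toFun (Icc 0 1))
      (iteratedDerivWithin 2 φ.toFun (Icc 0 1) x) (Icc 0 1) x := by
  have hC1 : ContDiffOn ℝ 1 (derivWithin φ.toFun (Icc 0 1)) (Icc 0 1) :=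
    φ.contDiffOn.derivWithin (uniqueDiffOn_Icc zero_lt_one) (by norm_num)
  have hderiv := (hC1.differentiableOn (by norm_num) x hx).hasDerivWithinAt
  rwa [← iteratedDerivWithin_one, ← iteratedDerivWithin_succ, iteratedDerivWithin_one] at hderiv

/-- The nonlinearity `φ'' / φ'` of a diffeomorphism of `[0,1]`. -/
noncomputable def nonlinearity (x : ℝ) : ℝ :=
  iteratedDerivWithin 2 φ.toFun (Icc 0 1) x / derivWithin φ.toFun (Icc 0 1) x

theorem hasNonlinearityOn :
    HasNonlinearityOn φ.toFun (derivWithin φ.toFun (Icc 0 1)) φ.nonlinearity (Icc 0 1) where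
  hasDerivWithinAt _ hx := φ.hasDerivWithinAt hx
  deriv_pos := φ.deriv_pos
  hasDerivWithinAt_log x hx := (φ.hasDerivWithinAt_derivWithin hx).log (φ.deriv_pos x hx).ne'

theorem monotoneOn : MonotoneOn φ.toFun (Icc 0 1) :=
  monotoneOn_of_hasDerivWithinAt_nonneg (convex_Icc 0 1) φ.contDiffOn.continuousOn
    (fun _ hx => (φ.hasDerivWithinAt (interior_subset hx)).mono interior_subset)
    fun x hx => (φ.deriv_pos x (interior_subset hx)).le

theorem mapsTo : MapsTo φ.toFun (Icc 0 1) (Icc 0 1) := fun _ hx =>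
  ⟨φ.map_zero ▸ φ.monotoneOn (by simp) hx hx.1, φ.map_one ▸ φ.monotoneOn hx (by simp) hx.2⟩

/-- The conjugate `x ↦ 1 - φ (1 - x)` of `φ` by the reflection of `[0,1]`. -/
def reflect : LorenzDiffeo where
  toFun x := 1 - φ.toFun (1 - x)
  map_zero := by simp [φ.map_one]
  map_one := by simp [φ.map_zero]
  contDiffOn := contDiffOn_const.sub
    (φ.contDiffOn.comp (contDiffOn_const.sub contDiffOn_id) fun _ => one_sub_mem_Icc_zero_one)
  deriv_pos x hx := by
    rw [derivWithin_one_sub_comp_one_sub]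
    exact φ.deriv_pos _ (one_sub_mem_Icc_zero_one hx)
  schwarzian_nonpos x hx := by
    rw [schwarzianOn_one_sub_comp_one_sub]
    exact φ.schwarzian_nonpos _ (one_sub_mem_Icc_zero_one hx)

theorem reflect_toFun (x : ℝ) : φ.reflect.toFun x = 1 - φ.toFun (1 - x) := rfl

theorem reflect_toFun_one_sub (x : ℝ) : φ.reflect.toFun (1 - x) = 1 - φ.toFun x := by
  rw [reflect_toFun, sub_sub_cancel]

theorem reflect_reflect : φ.reflect.reflect = φ := by
  obtain ⟨f, _, _, _, _, _⟩ := φ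
  simp [reflect]

variable {φ}

theorem CloseToId.mono {ε : ℝ} (h : φ.CloseToId δ) (hδ : δ ≤ ε) : φ.CloseToId ε := fun x hx =>
  ⟨(h x hx).1.trans hδ, (h x hx).2.1.trans hδ, (h x hx).2.2.trans hδ⟩

theorem CloseToId.reflect (h : φ.CloseToId δ) : φ.reflect.CloseToId δ := fun x hx => by
  obtain ⟨h0, h1, h2⟩ := h (1 - x) (one_sub_mem_Icc_zero_one hx)
  refine ⟨?_, ?_, ?_⟩
  · rwa [reflect_toFun, show 1 - φ.toFun (1 - x) - x = -(φ.toFun (1 - x) - (1 - x)) by ring,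
      abs_neg]
  · rwa [show φ.reflect.toFun = fun y => 1 - φ.toFun (1 - y) from rfl,
      derivWithin_one_sub_comp_one_sub]
  · rwa [show φ.reflect.toFun = fun y => 1 - φ.toFun (1 - y) from rfl,
      iteratedDerivWithin_one_sub_comp_one_sub _ two_pos, abs_mul, abs_neg_one_pow, one_mul]

theorem CloseToId.abs_nonlinearity_le (h : φ.CloseToId δ) (hδ : δ ≤ 1 / 2)
    (hx : x ∈ Icc (0 : ℝ) 1) : |φ.nonlinearity x| ≤ 2 * δ := by
  obtain ⟨-, h1, h2⟩ := h x hx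
  have hpos := φ.deriv_pos x hx
  rw [nonlinearity, abs_div, abs_of_pos hpos, div_le_iff₀ hpos]
  nlinarith [(abs_le.1 h1).1, (abs_nonneg _).trans h1]

theorem CloseToId.abs_sub_sub_sub_le (h : φ.CloseToId δ) (hx : x ∈ Icc (0 : ℝ) 1)
    (hy : y ∈ Icc (0 : ℝ) 1) (hxy : x ≤ y) :
    |φ.toFun y - φ.toFun x - (y - x)| ≤ δ * (y - x) := by
  have hdist := abs_sub_le_of_abs_deriv_le (convex_Icc 0 1)
    (fun z hz => (φ.hasDerivWithinAt hz).sub (hasDerivWithinAt_id z _))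
    (fun z _ => (hasDerivWithinAt_id z _).const_mul δ)
    (fun z hz => (h z hz).2.1.trans_eq (mul_one δ).symm) hx hy hxy
  simpa only [Pi.sub_apply, id, sub_sub_sub_comm, mul_sub] using hdist

theorem CloseToId.le_sub (h : φ.CloseToId δ) (hδ : δ ≤ 1 / 2) (hx : x ∈ Icc (0 : ℝ) 1)
    (hy : y ∈ Icc (0 : ℝ) 1) (hxy : x ≤ y) : (y - x) / 2 ≤ φ.toFun y - φ.toFun x := by
  nlinarith [(abs_le.1 (h.abs_sub_sub_sub_le hx hy hxy)).1]

theorem CloseToId.sub_le (h : φ.CloseToId δ) (hδ : δ ≤ 1 / 2) (hx : x ∈ Icc (0 : ℝ) 1)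
    (hy : y ∈ Icc (0 : ℝ) 1) (hxy : x ≤ y) : φ.toFun y - φ.toFun x ≤ 2 * (y - x) := by
  nlinarith [(abs_le.1 (h.abs_sub_sub_sub_le hx hy hxy)).2]

theorem exists_derivWithin_eq_one (φ : LorenzDiffeo) :
    ∃ w ∈ Icc (0 : ℝ) 1, derivWithin φ.toFun (Icc 0 1) w = 1 := by
  obtain ⟨w, hw, hslope⟩ := exists_hasDerivAt_eq_slope φ.toFun _ zero_lt_one
    φ.contDiffOn.continuousOn fun x hx =>
      (φ.hasDerivWithinAt (Ioo_subset_Icc_self hx)).hasDerivAt (Icc_mem_nhds hx.1 hx.2)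
  exact ⟨w, Ioo_subset_Icc_self hw, by rw [hslope, φ.map_zero, φ.map_one]; norm_num⟩

theorem abs_log_derivWithin_le (φ : LorenzDiffeo) {E : ℝ} (h : ∀ y ∈ Icc (0 : ℝ) 1,
    |φ.nonlinearity y| ≤ E * (1 + derivWithin φ.toFun (Icc 0 1) y)) (hx : x ∈ Icc (0 : ℝ) 1) :
    |Real.log (derivWithin φ.toFun (Icc 0 1) x)| ≤ 2 * E := by
  have h0 : (0 : ℝ) ∈ Icc (0 : ℝ) 1 := by simp
  have hE : 0 ≤ E := nonneg_of_mul_nonneg_left ((abs_nonneg _).trans (h 0 h0))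
    (by linarith [φ.deriv_pos 0 h0])
  obtain ⟨w, hw, hone⟩ := φ.exists_derivWithin_eq_one
  have hvar {y z : ℝ} (hy : y ∈ Icc (0 : ℝ) 1) (hz : z ∈ Icc (0 : ℝ) 1) (hyz : y ≤ z) :
      |Real.log (derivWithin φ.toFun (Icc 0 1) z) -
        Real.log (derivWithin φ.toFun (Icc 0 1) y)| ≤ 2 * E := by
    have hbound := abs_sub_le_of_abs_deriv_le (convex_Icc 0 1)
      φ.hasNonlinearityOn.hasDerivWithinAt_log
      (fun z hz => ((hasDerivWithinAt_id z _).add (φ.hasDerivWithinAt hz)).const_mul E) h hy hz hyz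
    simp only [Pi.add_apply, id] at hbound
    nlinarith [hy.1, hz.2, (φ.mapsTo hy).1, (φ.mapsTo hz).2]
  rcases le_total w x with hwx | hxw
  · simpa [hone] using hvar hw hx hwx
  · simpa [hone] using hvar hx hw hxw

theorem closeToId_of_abs_nonlinearity_le (φ : LorenzDiffeo) {E : ℝ} (hE : E ≤ 1 / 4)
    (h : ∀ y ∈ Icc (0 : ℝ) 1, |φ.nonlinearity y| ≤ E * (1 + derivWithin φ.toFun (Icc 0 1) y)) :
    φ.CloseToId (6 * E) := by
  have hderiv : ∀ x ∈ Icc (0 : ℝ) 1, |derivWithin φ.toFun (Icc 0 1) x - 1| ≤ 4 * E := by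
    intro x hx
    have hlog := φ.abs_log_derivWithin_le h hx
    have hexp := Real.abs_exp_sub_one_le (hlog.trans (by linarith))
    rw [Real.exp_log (φ.deriv_pos x hx)] at hexp
    linarith
  have hE0 : 0 ≤ E := by linarith [(abs_nonneg _).trans (hderiv 0 (by simp))]
  intro x hx
  refine ⟨?_, (hderiv x hx).trans (by linarith), ?_⟩
  · have hdist := abs_sub_le_of_abs_deriv_le (convex_Icc 0 1)
      (fun z hz => (φ.hasDerivWithinAt hz).sub (hasDerivWithinAt_id z _))
      (fun z _ => (hasDerivWithinAt_id z _).const_mul (4 * E))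
      (fun z hz => (hderiv z hz).trans_eq (mul_one _).symm) (by simp) hx hx.1
    simp only [Pi.sub_apply, id, φ.map_zero, sub_zero] at hdist
    nlinarith [hx.2]
  · have hpos := φ.deriv_pos x hx
    have hN := h x hx
    rw [nonlinearity, abs_div, abs_of_pos hpos, div_le_iff₀ hpos] at hN
    have htwo : derivWithin φ.toFun (Icc 0 1) x ≤ 2 := by linarith [(abs_le.1 (hderiv x hx)).2]
    nlinarith [mul_nonneg hE0 hpos.le]

end LorenzDiffeo

/-- The positive solution `w` of `w = 2 (w / c₀)^α`. It bounds the distance of the critical values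
to the critical point from below. -/
noncomputable def criticalMargin (α c₀ : ℝ) : ℝ := (c₀ ^ α / 2) ^ (α - 1)⁻¹

theorem criticalMargin_pos {α c₀ : ℝ} (hc₀ : 0 < c₀) : 0 < criticalMargin α c₀ := by
  unfold criticalMargin
  positivity

theorem criticalMargin_le {α c₀ w : ℝ} (hα : 1 < α) (hc₀ : 0 < c₀) (hw : 0 < w)
    (hle : w ≤ 2 * (w / c₀) ^ α) : criticalMargin α c₀ ≤ w := by
  refine (Real.rpow_inv_le_iff_of_pos (by positivity) hw.le (sub_pos.2 hα)).2 ?_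
  have hpow : 0 < c₀ ^ α := Real.rpow_pos_of_pos hc₀ α
  rw [Real.div_rpow hw.le hc₀.le, ← mul_div_assoc, le_div_iff₀ hpow] at hle
  rw [Real.rpow_sub_one hw.ne', div_le_div_iff₀ two_pos hw]
  linarith

theorem criticalMargin_le_of_le_of_le {α c₀ w w' : ℝ} (hα : 1 < α) (hc₀ : 0 < c₀) (hw : 0 < w)
    (hw' : 0 < w') (hle : w ≤ 2 * (w' / c₀) ^ α) (hle' : w' ≤ 2 * (w / c₀) ^ α) :
    criticalMargin α c₀ ≤ w := by
  rcases le_total w w' with h | h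
  · exact criticalMargin_le hα hc₀ hw (h.trans hle')
  · exact (criticalMargin_le hα hc₀ hw' (h.trans hle)).trans h

theorem standardLorenz_one_sub {α u v c x : ℝ} (hx : x ≠ c) :
    standardLorenz α v u (1 - c) (1 - x) = 1 - standardLorenz α u v c x := by
  rcases hx.lt_or_gt with hlt | hgt
  · rw [standardLorenz, standardLorenz, if_neg (by linarith), if_pos hlt]
    ring_nf
  · rw [standardLorenz, standardLorenz, if_pos (by linarith), if_neg (not_lt.2 hgt.le)]
    ring_nf

namespace LorenzMap

variable {α : ℝ} (f : LorenzMap α) {a b : ℕ} {p q x ε : ℝ}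

theorem map_of_lt (hx : x < f.c) : f.map x = f.phiMinus.toFun (f.std x) := if_pos hx

theorem map_of_le (hx : f.c ≤ x) : f.map x = f.phiPlus.toFun (f.std x) := if_neg hx.not_gt

theorem std_of_lt (hx : x < f.c) : f.std x = f.u * (1 - ((f.c - x) / f.c) ^ α) := if_pos hx

theorem std_of_le (hx : f.c ≤ x) :
    f.std x = 1 + f.v * (-1 + ((x - f.c) / (1 - f.c)) ^ α) := if_neg hx.not_gt

/-- The conjugate of `f` by the reflection `x ↦ 1 - x` of `[0,1]`, which exchanges the branches. -/
def reflect : LorenzMap α where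
  c := 1 - f.c
  u := f.v
  v := f.u
  phiMinus := f.phiPlus.reflect
  phiPlus := f.phiMinus.reflect
  c_mem := ⟨sub_pos.2 f.c_mem.2, sub_lt_self 1 f.c_mem.1⟩
  u_mem := f.v_mem
  v_mem := f.u_mem
  le_critMinus := sub_le_sub_left f.critPlus_le 1
  critPlus_le := by
    rw [LorenzDiffeo.reflect_toFun_one_sub]
    exact sub_le_sub_left f.le_critMinus 1
  no_fixed_minus x hx hfix := by
    have hne : 1 - x ≠ f.c := by linarith [hx.2]
    have hstd := standardLorenz_one_sub (α := α) (u := f.u) (v := f.v) hne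
    rw [sub_sub_cancel] at hstd
    rw [hstd, LorenzDiffeo.reflect_toFun_one_sub] at hfix
    exact f.no_fixed_plus (1 - x) ⟨by linarith [hx.2], by linarith [hx.1]⟩ (by linarith)
  no_fixed_plus x hx hfix := by
    have hne : 1 - x ≠ f.c := by linarith [hx.1]
    have hstd := standardLorenz_one_sub (α := α) (u := f.u) (v := f.v) hne
    rw [sub_sub_cancel] at hstd
    rw [hstd, LorenzDiffeo.reflect_toFun_one_sub] at hfix
    exact f.no_fixed_minus (1 - x) ⟨by linarith [hx.2], by linarith [hx.1]⟩ (by linarith)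

theorem reflect_c : f.reflect.c = 1 - f.c := rfl

theorem reflect_map_one_sub (hx : x ≠ f.c) : f.reflect.map (1 - x) = 1 - f.map x := by
  have hstd : f.reflect.std (1 - x) = 1 - f.std x := standardLorenz_one_sub hx
  rcases hx.lt_or_gt with hlt | hgt
  · rw [map_of_le _ (sub_le_sub_left hlt.le 1), hstd, map_of_lt f hlt]
    exact f.phiMinus.reflect_toFun_one_sub _
  · rw [map_of_lt _ (sub_lt_sub_left hgt 1), hstd, map_of_le f hgt.le]
    exact f.phiPlus.reflect_toFun_one_sub _

theorem reflect_iterate_one_sub {n : ℕ} (hx : ∀ k < n, f.map^[k] x ≠ f.c) :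
    f.reflect.map^[n] (1 - x) = 1 - f.map^[n] x := by
  induction n with
  | zero => rfl
  | succ n ih =>
    rw [Function.iterate_succ_apply', Function.iterate_succ_apply',
      ih fun k hk => hx k (hk.trans n.lt_succ_self), reflect_map_one_sub f (hx n n.lt_succ_self)]

variable {f}

theorem CloseToStandard.reflect (h : f.CloseToStandard ε) : f.reflect.CloseToStandard ε :=
  ⟨h.2.reflect, h.1.reflect⟩

theorem IsFirstReturnTime.reflect {n : ℕ} (h : f.IsFirstReturnTime p q x n)
    (hx : ∀ k < n, f.map^[k] x ≠ f.c) :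
    f.reflect.IsFirstReturnTime (1 - q) (1 - p) (1 - x) n := by
  have hiter (k : ℕ) (hk : k ≤ n) : f.reflect.map^[k] (1 - x) ∈ Icc (1 - q) (1 - p) ↔
      f.map^[k] x ∈ Icc p q := by
    rw [f.reflect_iterate_one_sub fun j hj => hx j (hj.trans_le hk), mem_Icc, mem_Icc,
      sub_le_sub_iff_left, sub_le_sub_iff_left, and_comm]
  exact ⟨h.1, (hiter n le_rfl).2 h.2.1, fun k hk hkn => (hiter k hkn.le).not.2 (h.2.2 k hk hkn)⟩

theorem IsMonotoneType.iterate_ne_of_lt (h : f.IsMonotoneType a b p q) (hx : x ∈ Ico p f.c)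
    {k : ℕ} (hk : k ≤ a) : f.map^[k] x ≠ f.c := by
  rcases k.eq_zero_or_pos with rfl | hpos
  · exact hx.2.ne
  · exact ((h.2.2.1 x hx).2 k hpos hk).ne'

theorem IsMonotoneType.iterate_ne_of_gt (h : f.IsMonotoneType a b p q) (hx : x ∈ Ioc f.c q)
    {k : ℕ} (hk : k ≤ b) : f.map^[k] x ≠ f.c := by
  rcases k.eq_zero_or_pos with rfl | hpos
  · exact hx.1.ne'
  · exact ((h.2.2.2 x hx).2 k hpos hk).ne

theorem IsMonotoneType.reflect (h : f.IsMonotoneType a b p q) :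
    f.reflect.IsMonotoneType b a (1 - q) (1 - p) := by
  refine ⟨h.2.1, h.1, fun x hx => ?_, fun x hx => ?_⟩
  · have hx' : 1 - x ∈ Ioc f.c q := ⟨lt_sub_comm.1 hx.2, sub_le_comm.1 hx.1⟩
    obtain ⟨hret, hleft⟩ := h.2.2.2 _ hx'
    have hne (k : ℕ) (hk : k < b + 1) := h.iterate_ne_of_gt hx' (Nat.lt_succ_iff.1 hk)
    rw [← sub_sub_cancel 1 x]
    refine ⟨hret.reflect hne, fun k hk hkb => ?_⟩
    rw [f.reflect_iterate_one_sub fun j hj => hne j (by omega)]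
    exact sub_lt_sub_left (hleft k hk hkb) 1
  · have hx' : 1 - x ∈ Ico p f.c := ⟨le_sub_comm.1 hx.2, sub_lt_comm.1 hx.1⟩
    obtain ⟨hret, hright⟩ := h.2.2.1 _ hx'
    have hne (k : ℕ) (hk : k < a + 1) := h.iterate_ne_of_lt hx' (Nat.lt_succ_iff.1 hk)
    rw [← sub_sub_cancel 1 x]
    refine ⟨hret.reflect hne, fun k hk hka => ?_⟩
    rw [f.reflect_iterate_one_sub fun j hj => hne j (by omega)]
    exact sub_lt_sub_left (hright k hk hka) 1

variable (f) in
/-- `φ` is the rescaling to `[0,1]` of a monotone branch of `f₊ᵃ ∘ φ₋` onto `[p,q]`. This is the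
condition on `g.phiMinus` in `HasInducedParts`; the one on `g.phiPlus` is its reflection. -/
def HasInducedMinus (a : ℕ) (p q : ℝ) (φ : LorenzDiffeo) : Prop :=
  ∃ s t, 0 ≤ s ∧ s < t ∧ t ≤ 1 ∧ ∀ y ∈ Icc (0 : ℝ) 1,
    (∀ k < a, f.c < f.map^[k] (f.phiMinus.toFun (s + (t - s) * y))) ∧
      f.map^[a] (f.phiMinus.toFun (s + (t - s) * y)) = p + (q - p) * φ.toFun y

theorem HasInducedParts.hasInducedMinus {g : LorenzMap α} (h : f.HasInducedParts a b p q g) :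
    f.HasInducedMinus a p q g.phiMinus := by
  obtain ⟨⟨s, t, hs, hst, ht, hbranch, -⟩, -⟩ := h
  exact ⟨s, t, hs, hst, ht, hbranch⟩

theorem HasInducedParts.hasInducedMinus_reflect {g : LorenzMap α}
    (h : f.HasInducedParts a b p q g) :
    f.reflect.HasInducedMinus b (1 - q) (1 - p) g.phiPlus.reflect := by
  obtain ⟨-, s, t, hs, hst, ht, hbranch, -⟩ := h
  refine ⟨1 - t, 1 - s, sub_nonneg.2 ht, sub_lt_sub_left hst 1, sub_le_self 1 hs, fun y hy => ?_⟩
  obtain ⟨hleft, hend⟩ := hbranch (1 - y) (one_sub_mem_Icc_zero_one hy)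
  have hstart : f.reflect.phiMinus.toFun (1 - t + (1 - s - (1 - t)) * y) =
      1 - f.phiPlus.toFun (s + (t - s) * (1 - y)) := by
    rw [← f.phiPlus.reflect_toFun_one_sub]
    exact congrArg f.phiPlus.reflect.toFun (by ring)
  rw [hstart]
  refine ⟨fun k hk => ?_, ?_⟩
  · rw [f.reflect_iterate_one_sub fun j hj => (hleft j (hj.trans hk)).ne]
    exact sub_lt_sub_left (hleft k hk) 1
  · rw [f.reflect_iterate_one_sub fun j hj => (hleft j hj).ne, hend, LorenzDiffeo.reflect_toFun]
    ring

theorem cycles_subset_of_isClosed {A : Set ℝ} (hA : IsClosed A)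
    (hminus : ∀ k ≤ a, ∀ x ∈ Ico p f.c, f.map^[k] x ∈ A)
    (hplus : ∀ k ≤ b, ∀ x ∈ Ioc f.c q, f.map^[k] x ∈ A) : f.cycles a b p q ⊆ A := by
  refine union_subset (iUnion₂_subset fun k hk => ?_) (iUnion₂_subset fun k hk => ?_)
  · exact closure_minimal
      (image_subset_iff.2 (hminus k (Nat.lt_succ_iff.1 (Finset.mem_range.1 hk)))) hA
  · exact closure_minimal
      (image_subset_iff.2 (hplus k (Nat.lt_succ_iff.1 (Finset.mem_range.1 hk)))) hA

theorem IsMonotoneType.Ioo_subset_rightGap (h : f.IsMonotoneType a b p q) (hq : f.c < q) {d : ℝ}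
    (hd : d ≤ 1) (hfar : ∀ x ∈ Ico p f.c, ∀ k, 1 ≤ k → k ≤ a → d ≤ f.map^[k] x) :
    Ioo q d ⊆ f.rightGap a b p q := by
  have hcycles : f.cycles a b p q ⊆ Iic q ∪ Ici d := by
    refine cycles_subset_of_isClosed (isClosed_Iic.union isClosed_Ici)
      (fun k hk x hx => ?_) (fun k hk x hx => ?_) <;> rcases k.eq_zero_or_pos with rfl | hpos
    · exact Or.inl (hx.2.le.trans hq.le)
    · exact Or.inr (hfar x hx k hpos hk)
    · exact Or.inl hx.2
    · exact Or.inl (((h.2.2.2 x hx).2 k hpos hk).le.trans hq.le)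
  intro x hx
  refine ⟨hx.1, hx.2.le.trans hd, fun y hy hmem => ?_⟩
  rcases hcycles hmem with hle | hge
  · exact hy.1.not_ge hle
  · exact (hy.2.trans_lt hx.2).not_ge hge

theorem IsMonotoneType.Ioo_subset_leftGap (h : f.IsMonotoneType a b p q) (hp : p < f.c) {d : ℝ}
    (hd : 0 ≤ d) (hfar : ∀ x ∈ Ioc f.c q, ∀ k, 1 ≤ k → k ≤ b → f.map^[k] x ≤ d) :
    Ioo d p ⊆ f.leftGap a b p q := by
  have hcycles : f.cycles a b p q ⊆ Iic d ∪ Ici p := by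
    refine cycles_subset_of_isClosed (isClosed_Iic.union isClosed_Ici)
      (fun k hk x hx => ?_) (fun k hk x hx => ?_) <;> rcases k.eq_zero_or_pos with rfl | hpos
    · exact Or.inr hx.1
    · exact Or.inr (hp.le.trans ((h.2.2.1 x hx).2 k hpos hk).le)
    · exact Or.inr (hp.le.trans hx.1.le)
    · exact Or.inl (hfar x hx k hpos hk)
  intro x hx
  refine ⟨hd.trans hx.1.le, hx.2, fun y hy hmem => ?_⟩
  rcases hcycles hmem with hle | hge
  · exact (hx.1.trans_le hy.1).not_ge hle
  · exact hy.2.not_ge hge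

variable (f)

theorem std_mem_Icc_of_mem_Icc (hα : 0 < α) (hx : x ∈ Icc f.c 1) :
    f.std x ∈ Icc (0 : ℝ) 1 := by
  have hc : 0 < 1 - f.c := sub_pos.2 f.c_mem.2
  have hbase : 0 ≤ (x - f.c) / (1 - f.c) := div_nonneg (sub_nonneg.2 hx.1) hc.le
  have hpow := Real.rpow_nonneg hbase α
  have hpow1 := Real.rpow_le_one hbase ((div_le_one hc).2 (sub_le_sub_right hx.2 _)) hα.le
  rw [f.std_of_le hx.1]
  constructor <;> nlinarith [f.v_mem.1, f.v_mem.2]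

theorem std_mem_Icc_of_mem_Ico (hα : 0 < α) (hx : x ∈ Ico 0 f.c) : f.std x ∈ Icc (0 : ℝ) 1 := by
  have hstd : f.reflect.std (1 - x) = 1 - f.std x := standardLorenz_one_sub hx.2.ne
  have hmem := f.reflect.std_mem_Icc_of_mem_Icc hα
    (show 1 - x ∈ Icc (1 - f.c) 1 from ⟨sub_le_sub_left hx.2.le 1, sub_le_self 1 hx.1⟩)
  rw [hstd] at hmem
  simpa using one_sub_mem_Icc_zero_one hmem

theorem map_mem_Icc (hα : 0 < α) (hx : x ∈ Icc (0 : ℝ) 1) : f.map x ∈ Icc (0 : ℝ) 1 := by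
  rcases lt_or_ge x f.c with hlt | hge
  · rw [f.map_of_lt hlt]
    exact f.phiMinus.mapsTo (f.std_mem_Icc_of_mem_Ico hα ⟨hx.1, hlt⟩)
  · rw [f.map_of_le hge]
    exact f.phiPlus.mapsTo (f.std_mem_Icc_of_mem_Icc hα ⟨hge, hx.2⟩)

theorem iterate_mem_Icc (hα : 0 < α) (hx : x ∈ Icc (0 : ℝ) 1) (n : ℕ) :
    f.map^[n] x ∈ Icc (0 : ℝ) 1 :=
  (show MapsTo f.map (Icc 0 1) (Icc 0 1) from fun _ => f.map_mem_Icc hα).iterate n hx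

theorem v_pos : 0 < f.v := by
  refine f.v_mem.1.lt_of_ne fun hv => ?_
  have hle := f.critPlus_le
  rw [← hv, sub_zero, f.phiPlus.map_one] at hle
  exact hle.not_gt f.c_mem.2

theorem map_one_eq : f.map 1 = 1 := by
  rw [f.map_of_le f.c_mem.2.le, f.std_of_le f.c_mem.2.le,
    div_self (sub_pos.2 f.c_mem.2).ne', Real.one_rpow, neg_add_cancel, mul_zero, add_zero,
    f.phiPlus.map_one]

theorem map_c_eq (hα : 0 < α) : f.map f.c = f.phiPlus.toFun (1 - f.v) := by
  rw [f.map_of_le le_rfl, f.std_of_le le_rfl, sub_self, zero_div, Real.zero_rpow hα.ne']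
  ring_nf

/-- The derivative of the standard part of `f` on the right of `c`. -/
noncomputable def stdDerivPlus (x : ℝ) : ℝ :=
  f.v * (α * ((x - f.c) / (1 - f.c)) ^ (α - 1)) / (1 - f.c)

/-- The derivative of `f` on the right of `c`. -/
noncomputable def derivPlus (x : ℝ) : ℝ :=
  derivWithin f.phiPlus.toFun (Icc 0 1) (f.std x) * f.stdDerivPlus x

/-- The nonlinearity of `f` on the right of `c`. -/
noncomputable def nonlinearityPlus (x : ℝ) : ℝ :=
  f.phiPlus.nonlinearity (f.std x) * f.stdDerivPlus x + (α - 1) / (x - f.c)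

theorem hasNonlinearityOn_std (hα : 0 < α) :
    HasNonlinearityOn f.std f.stdDerivPlus (fun x => (α - 1) / (x - f.c)) (Ioi f.c) := by
  have hc : 0 < 1 - f.c := sub_pos.2 f.c_mem.2
  have hbase (x : ℝ) :
      -(f.c * (1 - f.c)⁻¹) + (1 - f.c)⁻¹ * x = (x - f.c) / (1 - f.c) := by ring
  have hmaps : MapsTo (fun x => -(f.c * (1 - f.c)⁻¹) + (1 - f.c)⁻¹ * x) (Ioi f.c) (Ioi 0) :=
    fun x hx => by
      simp only [hbase]
      exact div_pos (sub_pos.2 hx) hc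
  refine ((HasNonlinearityOn.affine (1 - f.v) f.v_pos univ).comp
    ((HasNonlinearityOn.rpow hα).comp (.affine _ (inv_pos.2 hc) _) hmaps) (mapsTo_univ _ _)).congr
    (fun x hx => ?_) (fun x _ => ?_) (fun x hx => ?_)
  · rw [f.std_of_le (le_of_lt hx)]
    simp only [Function.comp_apply, hbase]
    ring
  · simp only [stdDerivPlus, hbase]
    ring
  · have hx0 : x - f.c ≠ 0 := (sub_pos.2 hx).ne'
    simp only [hbase, Pi.zero_apply]
    field_simp
    ring

theorem hasNonlinearityOn_map (hα : 0 < α) :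
    HasNonlinearityOn f.map f.derivPlus f.nonlinearityPlus (Ioc f.c 1) :=
  (f.phiPlus.hasNonlinearityOn.comp ((f.hasNonlinearityOn_std hα).mono Ioc_subset_Ioi_self)
    fun _ hx => f.std_mem_Icc_of_mem_Icc hα (Ioc_subset_Icc_self hx)).congr
    (fun _ hx => f.map_of_le hx.1.le) (fun _ _ => rfl) (fun _ _ => rfl)

theorem stdDerivPlus_mem_Icc (hα : 1 < α) (hx : x ∈ Ioc f.c 1) :
    f.stdDerivPlus x ∈ Icc 0 (α / (x - f.c)) := by
  have hc : 0 < 1 - f.c := sub_pos.2 f.c_mem.2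
  have hxc : 0 < x - f.c := sub_pos.2 hx.1
  have hbase : 0 < (x - f.c) / (1 - f.c) := div_pos hxc hc
  have hpow := Real.rpow_le_one hbase.le ((div_le_one hc).2 (sub_le_sub_right hx.2 _))
    (zero_lt_one.trans hα).le
  have heq : f.stdDerivPlus x = f.v * ((x - f.c) / (1 - f.c)) ^ α * (α / (x - f.c)) := by
    rw [stdDerivPlus, Real.rpow_sub_one hbase.ne']
    field_simp
  have hle : f.v * ((x - f.c) / (1 - f.c)) ^ α ≤ 1 :=
    mul_le_one₀ f.v_mem.2 (Real.rpow_nonneg hbase.le α) hpow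
  have hquot : 0 ≤ α / (x - f.c) := by positivity
  rw [heq]
  exact ⟨mul_nonneg (mul_nonneg f.v_mem.1 (Real.rpow_nonneg hbase.le α)) hquot,
    mul_le_of_le_one_left hquot hle⟩

theorem nonlinearityPlus_mem_Icc (hα : 1 < α) (hclose : f.phiPlus.CloseToId ((α - 1) / (2 * α)))
    (hx : x ∈ Ioc f.c 1) : f.nonlinearityPlus x ∈ Icc 0 (2 * (α - 1) / (x - f.c)) := by
  have hα0 : 0 < α := zero_lt_one.trans hα
  have hxc : 0 < x - f.c := sub_pos.2 hx.1
  obtain ⟨hnonneg, hle⟩ := f.stdDerivPlus_mem_Icc hα hx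
  have hN := hclose.abs_nonlinearity_le (by rw [div_le_iff₀ (by positivity)]; linarith)
    (f.std_mem_Icc_of_mem_Icc hα0 (Ioc_subset_Icc_self hx))
  have habs : |f.phiPlus.nonlinearity (f.std x) * f.stdDerivPlus x| ≤ (α - 1) / (x - f.c) := by
    rw [abs_mul, abs_of_nonneg hnonneg]
    calc |f.phiPlus.nonlinearity (f.std x)| * f.stdDerivPlus x
        ≤ 2 * ((α - 1) / (2 * α)) * (α / (x - f.c)) :=
          mul_le_mul hN hle hnonneg ((abs_nonneg _).trans hN)
      _ = (α - 1) / (x - f.c) := by field_simp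
  obtain ⟨hlower, hupper⟩ := abs_le.1 habs
  rw [nonlinearityPlus, mul_div_assoc, two_mul]
  constructor <;> linarith

variable {f} {η c₀ : ℝ}

theorem continuousOn_map (hα : 0 < α) : ContinuousOn f.map (Icc f.c 1) := by
  have hstd : ContinuousOn f.std (Icc f.c 1) := by
    have hcont : Continuous fun x => 1 + f.v * (-1 + ((x - f.c) / (1 - f.c)) ^ α) :=
      continuous_const.add (continuous_const.mul (continuous_const.add
        (((continuous_id.sub continuous_const).div_const _).rpow_const fun _ => Or.inr hα.le)))
    exact hcont.continuousOn.congr fun x hx => f.std_of_le hx.1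
  exact (f.phiPlus.contDiffOn.continuousOn.comp hstd
    fun x hx => f.std_mem_Icc_of_mem_Icc hα hx).congr fun x hx => f.map_of_le hx.1

theorem convexOn_map (hα : 1 < α) (hclose : f.phiPlus.CloseToId ((α - 1) / (2 * α))) :
    ConvexOn ℝ (Icc f.c 1) f.map :=
  (f.hasNonlinearityOn_map (zero_lt_one.trans hα)).convexOn_Icc
    (f.continuousOn_map (zero_lt_one.trans hα))
    fun _ hx => (f.nonlinearityPlus_mem_Icc hα hclose hx).1

theorem map_sub_map_c_le (hα : 0 < α) {δ : ℝ} (hclose : f.phiPlus.CloseToId δ) (hδ : δ ≤ 1 / 2)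
    (hx : x ∈ Icc f.c 1) : f.map x - f.map f.c ≤ 2 * ((x - f.c) / (1 - f.c)) ^ α := by
  have hc : 0 < 1 - f.c := sub_pos.2 f.c_mem.2
  have hpow : 0 ≤ ((x - f.c) / (1 - f.c)) ^ α :=
    Real.rpow_nonneg (div_nonneg (sub_nonneg.2 hx.1) hc.le) α
  have hstd : f.std x - f.std f.c = f.v * ((x - f.c) / (1 - f.c)) ^ α := by
    rw [f.std_of_le hx.1, f.std_of_le le_rfl, sub_self f.c, zero_div, Real.zero_rpow hα.ne']
    ring
  rw [f.map_of_le hx.1, f.map_of_le le_rfl]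
  refine (hclose.sub_le hδ (f.std_mem_Icc_of_mem_Icc hα ⟨le_rfl, f.c_mem.2.le⟩)
    (f.std_mem_Icc_of_mem_Icc hα hx) (sub_nonneg.1 (hstd ▸ mul_nonneg f.v_mem.1 hpow))).trans ?_
  rw [hstd]
  exact mul_le_mul_of_nonneg_left (mul_le_of_le_one_left hpow f.v_mem.2) zero_le_two

/-- `f` is close to standard maps, `c` is at distance at least `c₀` from `1` and the critical value
`f₊(c)` is at distance at least `η` from `c`. Then the right branch of `f` expands away from its
fixed point `1`, uniformly in terms of `η`, and its distortion is controlled by `c₀` and `η`. -/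
structure HasExpandingPlus (f : LorenzMap α) (c₀ η : ℝ) : Prop where
  one_lt : 1 < α
  closeToStandard : f.CloseToStandard ((α - 1) / (2 * α))
  c₀_pos : 0 < c₀
  c₀_le : c₀ ≤ 1 - f.c
  η_pos : 0 < η
  map_c_le : f.map f.c ≤ f.c - η

theorem closeness_le_half (hα : 1 < α) : (α - 1) / (2 * α) ≤ 1 / 2 := by
  rw [div_le_iff₀ (by linarith)]
  linarith

/-- A radius around `c` which the points of a long passage near the fixed point `1` avoid. -/
noncomputable def criticalRadius (α c₀ η : ℝ) : ℝ := (η / 4) ^ α⁻¹ * c₀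

theorem criticalRadius_pos (hc₀ : 0 < c₀) (hη : 0 < η) : 0 < criticalRadius α c₀ η := by
  unfold criticalRadius
  positivity

/-- A bound for the nonlinearity of the right branch outside of the critical radius. -/
noncomputable def nonlinearityBound (α c₀ η : ℝ) : ℝ := 2 * (α - 1) / criticalRadius α c₀ η

namespace HasExpandingPlus

theorem pos (h : f.HasExpandingPlus c₀ η) : 0 < α := zero_lt_one.trans h.one_lt

theorem nonlinearityBound_nonneg (h : f.HasExpandingPlus c₀ η) : 0 ≤ nonlinearityBound α c₀ η :=
  div_nonneg (by linarith [h.one_lt]) (criticalRadius_pos h.c₀_pos h.η_pos).le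

theorem mul_one_sub_le (h : f.HasExpandingPlus c₀ η) (hx : x ∈ Icc f.c 1) :
    (1 + η) * (1 - x) ≤ 1 - f.map x := by
  have hc : 0 < 1 - f.c := sub_pos.2 f.c_mem.2
  set w := (1 - x) / (1 - f.c)
  have hw0 : 0 ≤ w := div_nonneg (sub_nonneg.2 hx.2) hc.le
  have hw1 : w ≤ 1 := (div_le_one hc).2 (sub_le_sub_left hx.1 1)
  have hmul : w * (1 - f.c) = 1 - x := div_mul_cancel₀ _ hc.ne'
  have hpoint : w • f.c + (1 - w) • (1 : ℝ) = x := by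
    simp only [smul_eq_mul]
    linarith
  have hconv : f.map x ≤ w * f.map f.c + (1 - w) := by
    have := (convexOn_map h.one_lt h.closeToStandard.2).2 (left_mem_Icc.2 f.c_mem.2.le)
      (right_mem_Icc.2 f.c_mem.2.le) hw0 (sub_nonneg.2 hw1) (add_sub_cancel w 1)
    rwa [hpoint, f.map_one_eq, smul_eq_mul, smul_eq_mul, mul_one] at this
  calc (1 + η) * (1 - x) = w * (1 - f.c + η) - w * η * f.c := by
        rw [← hmul]
        ring
    _ ≤ w * (1 - f.c + η) := sub_le_self _ (mul_nonneg (mul_nonneg hw0 h.η_pos.le) f.c_mem.1.le)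
    _ ≤ w * (1 - f.map f.c) := mul_le_mul_of_nonneg_left (by linarith [h.map_c_le]) hw0
    _ ≤ 1 - f.map x := by linarith

theorem one_add_le_derivPlus_one (h : f.HasExpandingPlus c₀ η) : 1 + η ≤ f.derivPlus 1 := by
  have hc : 0 < 1 - f.c := sub_pos.2 f.c_mem.2
  have hleft : f.c ∈ Icc f.c 1 := left_mem_Icc.2 f.c_mem.2.le
  have hright : (1 : ℝ) ∈ Icc f.c 1 := right_mem_Icc.2 f.c_mem.2.le
  have hderiv : HasDerivWithinAt f.map (f.derivPlus 1) (Iio 1) 1 :=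
    HasDerivWithinAt.mono_of_mem_nhdsWithin
      ((f.hasNonlinearityOn_map h.pos).hasDerivWithinAt 1 (right_mem_Ioc.2 f.c_mem.2))
      (mem_of_superset (Ioo_mem_nhdsLT f.c_mem.2) Ioo_subset_Ioc_self)
  have hslope := (convexOn_map h.one_lt h.closeToStandard.2).slope_le_of_hasDerivWithinAt_Iio
    hleft hright f.c_mem.2 hderiv
  rw [slope_def_field, f.map_one_eq] at hslope
  exact ((le_div_iff₀ hc).2 (h.mul_one_sub_le hleft)).trans hslope

theorem abs_nonlinearityPlus_le (h : f.HasExpandingPlus c₀ η)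
    (hx : x ∈ Icc (f.c + criticalRadius α c₀ η) 1) :
    |f.nonlinearityPlus x| ≤ nonlinearityBound α c₀ η := by
  have hr := criticalRadius_pos (α := α) h.c₀_pos h.η_pos
  obtain ⟨hnonneg, hle⟩ := f.nonlinearityPlus_mem_Icc h.one_lt h.closeToStandard.2
    ⟨by linarith [hx.1], hx.2⟩
  rw [abs_of_nonneg hnonneg]
  exact hle.trans (div_le_div_of_nonneg_left (by linarith [h.one_lt]) hr (by linarith [hx.1]))

theorem one_add_le_exp_mul_derivPlus (h : f.HasExpandingPlus c₀ η)
    (hx : x ∈ Icc (f.c + criticalRadius α c₀ η) 1) :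
    1 + η ≤ Real.exp (nonlinearityBound α c₀ η * (1 - x)) * f.derivPlus x := by
  have hr := criticalRadius_pos (α := α) h.c₀_pos h.η_pos
  have hsubset : Icc (f.c + criticalRadius α c₀ η) 1 ⊆ Ioc f.c 1 :=
    fun y hy => ⟨by linarith [hy.1], hy.2⟩
  exact h.one_add_le_derivPlus_one.trans
    (((f.hasNonlinearityOn_map h.pos).mono hsubset).deriv_le_exp_mul_deriv (convex_Icc _ _)
      (fun y => h.abs_nonlinearityPlus_le) hx (right_mem_Icc.2 (hx.1.trans hx.2)) hx.2)

theorem add_criticalRadius_le (h : f.HasExpandingPlus c₀ η) (hx : x ∈ Icc f.c 1)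
    (hmap : f.c - η / 2 ≤ f.map x) :
    f.c + criticalRadius α c₀ η ≤ x := by
  have hc : 0 < 1 - f.c := sub_pos.2 f.c_mem.2
  have hbase : 0 ≤ (x - f.c) / (1 - f.c) := div_nonneg (sub_nonneg.2 hx.1) hc.le
  have hpow : η / 4 ≤ ((x - f.c) / (1 - f.c)) ^ α := by
    linarith [map_sub_map_c_le h.pos h.closeToStandard.2 (closeness_le_half h.one_lt) hx,
      h.map_c_le]
  have hroot := (Real.rpow_inv_le_iff_of_pos (by linarith [h.η_pos]) hbase h.pos).2 hpow
  rw [le_div_iff₀ hc] at hroot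
  have hradius : criticalRadius α c₀ η ≤ (η / 4) ^ α⁻¹ * (1 - f.c) :=
    mul_le_mul_of_nonneg_left h.c₀_le (Real.rpow_nonneg (by linarith [h.η_pos]) _)
  linarith

theorem one_sub_le_pow (h : f.HasExpandingPlus c₀ η) {n : ℕ}
    (horbit : ∀ k < n, f.map^[k] x ∈ Icc f.c 1) (hend : 0 ≤ f.map^[n] x) :
    1 - x ≤ (1 + η)⁻¹ ^ n := by
  have hη := h.η_pos
  induction n generalizing x with
  | zero => simpa using hend
  | succ n ih =>
    have hnext := ih (x := f.map x) (fun k hk => horbit (k + 1) (Nat.succ_lt_succ hk)) hend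
    rw [pow_succ', le_inv_mul_iff₀ (by linarith)]
    exact (h.mul_one_sub_le (horbit 0 n.succ_pos)).trans hnext

theorem sub_le_two_mul_pow (h : f.HasExpandingPlus c₀ η) {n : ℕ} {s t : ℝ} (hs : 0 ≤ s)
    (hst : s ≤ t) (ht : t ≤ 1) (horbit : ∀ k < n, f.map^[k] (f.phiMinus.toFun s) ∈ Icc f.c 1)
    (hend : 0 ≤ f.map^[n] (f.phiMinus.toFun s)) : t - s ≤ 2 * (1 + η)⁻¹ ^ n := by
  linarith [h.one_sub_le_pow horbit hend, (f.phiMinus.mapsTo ⟨hs.trans hst, ht⟩).2,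
    h.closeToStandard.1.le_sub (closeness_le_half h.one_lt) ⟨hs, hst.trans ht⟩
      ⟨hs.trans hst, ht⟩ hst]

end HasExpandingPlus

theorem prod_derivPlus_nonneg (hα : 0 < α) {n : ℕ} (horbit : ∀ k < n, f.map^[k] x ∈ Ioc f.c 1) :
    0 ≤ ∏ i ∈ Finset.range n, f.derivPlus (f.map^[i] x) :=
  Finset.prod_nonneg fun i hi =>
    ((f.hasNonlinearityOn_map hα).deriv_pos _ (horbit i (Finset.mem_range.1 hi))).le

/-- A bound for the distortion of the long passages near the fixed point `1`, relative to the size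
of their image. -/
noncomputable def distortionBound (α c₀ η : ℝ) : ℝ :=
  nonlinearityBound α c₀ η *
    (Real.exp (nonlinearityBound α c₀ η / (1 - (1 + η)⁻¹)) / (1 - (1 + η)⁻¹))

namespace HasExpandingPlus

theorem η_le (h : f.HasExpandingPlus c₀ η) : η ≤ f.c := by
  linarith [h.map_c_le, (f.map_mem_Icc h.pos ⟨f.c_mem.1.le, f.c_mem.2.le⟩).1]

theorem rate_lt_one (h : f.HasExpandingPlus c₀ η) : (1 + η)⁻¹ < 1 :=
  inv_lt_one_of_one_lt₀ (by linarith [h.η_pos])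

theorem distortionBound_nonneg (h : f.HasExpandingPlus c₀ η) : 0 ≤ distortionBound α c₀ η :=
  mul_nonneg h.nonlinearityBound_nonneg
    (div_nonneg (Real.exp_pos _).le (sub_nonneg.2 h.rate_lt_one.le))

theorem add_criticalRadius_le_iterate (h : f.HasExpandingPlus c₀ η) {n : ℕ}
    (horbit : ∀ k < n, f.map^[k] x ∈ Ioc f.c 1) (hend : f.c - η / 2 ≤ f.map^[n] x) {k : ℕ}
    (hk : k < n) :
    f.c + criticalRadius α c₀ η ≤ f.map^[k] x := by
  refine h.add_criticalRadius_le (Ioc_subset_Icc_self (horbit k hk)) ?_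
  rw [← Function.iterate_succ_apply' f.map]
  rcases (Nat.succ_le_of_lt hk).eq_or_lt with heq | hlt
  · rwa [heq]
  · linarith [(horbit _ hlt).1, h.η_pos]

theorem sum_prod_derivPlus_le (h : f.HasExpandingPlus c₀ η) {n : ℕ}
    (horbit : ∀ k < n, f.map^[k] x ∈ Ioc f.c 1) (hend : f.c - η / 2 ≤ f.map^[n] x) :
    ∑ j ∈ Finset.range n, ∏ i ∈ Finset.range j, f.derivPlus (f.map^[i] x) ≤
      Real.exp (nonlinearityBound α c₀ η / (1 - (1 + η)⁻¹)) / (1 - (1 + η)⁻¹) *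
        ∏ i ∈ Finset.range n, f.derivPlus (f.map^[i] x) := by
  have hη := h.η_pos
  have hprod (j : ℕ) (hj : j ≤ n) :=
    prod_derivPlus_nonneg h.pos fun k hk => horbit k (hk.trans_le hj)
  refine sum_range_le_of_le_mul_exp (by positivity) h.rate_lt_one h.nonlinearityBound_nonneg
    (hprod n le_rfl) fun j hj => ?_
  have hexpand := h.one_add_le_exp_mul_derivPlus
    ⟨h.add_criticalRadius_le_iterate horbit hend hj, (horbit j hj).2⟩
  have hnear : 1 - f.map^[j] x ≤ (1 + η)⁻¹ ^ (n - j) := by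
    refine h.one_sub_le_pow (fun k hk => ?_) ?_ <;> rw [← Function.iterate_add_apply]
    · exact Ioc_subset_Icc_self (horbit (k + j) (by omega))
    · rw [Nat.sub_add_cancel hj.le]
      linarith [h.η_le]
  have hone : 1 ≤ (1 + η)⁻¹ * Real.exp (nonlinearityBound α c₀ η * (1 + η)⁻¹ ^ (n - j)) *
      f.derivPlus (f.map^[j] x) := by
    rw [mul_assoc, le_inv_mul_iff₀ (by linarith), mul_one]
    have hderiv := (f.hasNonlinearityOn_map h.pos).deriv_pos _ (horbit j hj)
    refine hexpand.trans (mul_le_mul_of_nonneg_right (Real.exp_le_exp.2 ?_) hderiv.le)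
    exact mul_le_mul_of_nonneg_left hnear h.nonlinearityBound_nonneg
  rw [Finset.prod_range_succ, ← mul_assoc, mul_right_comm]
  exact le_mul_of_one_le_left (hprod j hj.le) hone

theorem abs_sum_nonlinearityPlus_le (h : f.HasExpandingPlus c₀ η) {n : ℕ}
    (horbit : ∀ k < n, f.map^[k] x ∈ Ioc f.c 1) (hend : f.c - η / 2 ≤ f.map^[n] x) {e : ℝ}
    (he : 0 ≤ e) :
    |∑ j ∈ Finset.range n, f.nonlinearityPlus (f.map^[j] x) *
      ((∏ i ∈ Finset.range j, f.derivPlus (f.map^[i] x)) * e)| ≤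
      distortionBound α c₀ η * ((∏ i ∈ Finset.range n, f.derivPlus (f.map^[i] x)) * e) := by
  have hterm : ∀ j ∈ Finset.range n, |f.nonlinearityPlus (f.map^[j] x) *
      ((∏ i ∈ Finset.range j, f.derivPlus (f.map^[i] x)) * e)| ≤
      nonlinearityBound α c₀ η * e * ∏ i ∈ Finset.range j, f.derivPlus (f.map^[i] x) := by
    intro j hj
    have hj := Finset.mem_range.1 hj
    have hprod := prod_derivPlus_nonneg h.pos fun k hk => horbit k (hk.trans hj)
    rw [abs_mul, abs_of_nonneg (mul_nonneg hprod he), mul_assoc, mul_comm e]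
    exact mul_le_mul_of_nonneg_right (h.abs_nonlinearityPlus_le
      ⟨h.add_criticalRadius_le_iterate horbit hend hj, (horbit j hj).2⟩) (mul_nonneg hprod he)
  refine (Finset.abs_sum_le_sum_abs _ _).trans ((Finset.sum_le_sum hterm).trans ?_)
  rw [← Finset.mul_sum]
  refine (mul_le_mul_of_nonneg_left (h.sum_prod_derivPlus_le horbit hend)
    (mul_nonneg h.nonlinearityBound_nonneg he)).trans_eq ?_
  rw [distortionBound]
  ring

end HasExpandingPlus

theorem HasInducedMinus.exists_small_branch {φ : LorenzDiffeo} (hφ : f.HasInducedMinus a p q φ)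
    (h : f.HasExpandingPlus c₀ η) :
    ∃ s t, s < t ∧ t - s ≤ 2 * (1 + η)⁻¹ ^ a ∧
      MapsTo (fun y => s + (t - s) * y) (Icc 0 1) (Icc 0 1) ∧ ∀ y ∈ Icc (0 : ℝ) 1,
        (∀ k < a, f.map^[k] (f.phiMinus.toFun (s + (t - s) * y)) ∈ Ioc f.c 1) ∧
          f.map^[a] (f.phiMinus.toFun (s + (t - s) * y)) = p + (q - p) * φ.toFun y := by
  obtain ⟨s, t, hs, hst, ht, hbranch⟩ := hφ
  have hmaps : MapsTo (fun y => s + (t - s) * y) (Icc 0 1) (Icc 0 1) := fun y hy =>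
    ⟨by nlinarith [hy.1], by nlinarith [hy.2]⟩
  have hmem (y : ℝ) (hy : y ∈ Icc (0 : ℝ) 1) (k : ℕ) :=
    f.iterate_mem_Icc h.pos (f.phiMinus.mapsTo (hmaps hy)) k
  have horbit : ∀ y ∈ Icc (0 : ℝ) 1, ∀ k < a,
      f.map^[k] (f.phiMinus.toFun (s + (t - s) * y)) ∈ Ioc f.c 1 := fun y hy k hk =>
    ⟨(hbranch y hy).1 k hk, (hmem y hy k).2⟩
  refine ⟨s, t, hst, h.sub_le_two_mul_pow hs hst.le ht (fun k hk => ?_) ?_, hmaps,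
    fun y hy => ⟨horbit y hy, (hbranch y hy).2⟩⟩
  · simpa using Ioc_subset_Icc_self (horbit 0 (by simp) k hk)
  · simpa using (hmem 0 (by simp) a).1

theorem HasInducedMinus.abs_nonlinearity_le {φ : LorenzDiffeo} (hφ : f.HasInducedMinus a p q φ)
    (h : f.HasExpandingPlus c₀ η) (hpq : p < q) (hp : f.c - p ≤ η / 2) {y : ℝ}
    (hy : y ∈ Icc (0 : ℝ) 1) :
    |φ.nonlinearity y| ≤ 2 * (1 + η)⁻¹ ^ a +
      distortionBound α c₀ η * ((q - p) * derivWithin φ.toFun (Icc 0 1) y) := by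
  obtain ⟨s, t, hst, hsize, hmaps, hbranch⟩ := hφ.exists_small_branch h
  have hts : 0 < t - s := sub_pos.2 hst
  have hend : f.c - η / 2 ≤ f.map^[a] (f.phiMinus.toFun (s + (t - s) * y)) := by
    rw [(hbranch y hy).2]
    nlinarith [(φ.mapsTo hy).1]
  obtain ⟨hderiv, hnonlin⟩ := ((f.hasNonlinearityOn_map h.pos).iterate_comp
    (f.phiMinus.hasNonlinearityOn.comp (.affine s hts _) hmaps) a
    fun k hk y hy => (hbranch y hy).1 k hk).eqOn
    ((HasNonlinearityOn.affine p (sub_pos.2 hpq) univ).comp φ.hasNonlinearityOn (mapsTo_univ _ _))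
    (uniqueDiffOn_Icc zero_lt_one) fun y hy => (hbranch y hy).2
  have hderiv := hderiv hy
  have hnonlin := hnonlin hy
  simp only [Function.comp_apply, Pi.zero_apply, zero_mul, zero_add, add_zero] at hderiv hnonlin
  have hfirst : |f.phiMinus.nonlinearity (s + (t - s) * y) * (t - s)| ≤ t - s := by
    rw [abs_mul, abs_of_pos hts]
    exact mul_le_of_le_one_left hts.le
      ((h.closeToStandard.1.abs_nonlinearity_le (closeness_le_half h.one_lt) (hmaps hy)).trans
        (by linarith [closeness_le_half h.one_lt]))
  have hlast := h.abs_sum_nonlinearityPlus_le (hbranch y hy).1 hend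
    (mul_pos (f.phiMinus.deriv_pos _ (hmaps hy)) hts).le
  rw [hderiv] at hlast
  rw [← hnonlin, add_comm (2 * _)]
  exact (abs_add_le _ _).trans (add_le_add hlast (hfirst.trans hsize))

namespace IsMonotoneType

theorem iterate_map_mem_Ioc (hmono : f.IsMonotoneType a b p q) (hα : 0 < α) (hp : 0 ≤ p)
    (hx : x ∈ Ico p f.c) {k : ℕ} (hk : k < a) :
    f.map^[k] (f.map x) ∈ Ioc f.c 1 :=
  ⟨(hmono.2.2.1 x hx).2 (k + 1) k.succ_pos hk,
    (f.iterate_mem_Icc hα ⟨hp.trans hx.1, hx.2.le.trans f.c_mem.2.le⟩ (k + 1)).2⟩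

theorem iterate_map_mem_Icc (hmono : f.IsMonotoneType a b p q) (hx : x ∈ Ico p f.c) :
    f.map^[a] (f.map x) ∈ Icc p q :=
  (hmono.2.2.1 x hx).1.2.1

theorem c_sub_le_rpow (hmono : f.IsMonotoneType a b p q) (h : f.HasExpandingPlus c₀ η)
    (hp : p ∈ Ico 0 f.c) :
    f.c - p ≤ (2 * (1 + η)⁻¹ ^ a) ^ α⁻¹ := by
  have hpp : p ∈ Ico p f.c := left_mem_Ico.2 hp.2
  have hstd := f.std_mem_Icc_of_mem_Ico h.pos hp
  have hsize : 1 - f.std p ≤ 2 * (1 + η)⁻¹ ^ a := by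
    refine h.sub_le_two_mul_pow hstd.1 hstd.2 le_rfl (fun k hk => ?_) ?_ <;>
      rw [← f.map_of_lt hp.2]
    · exact Ioc_subset_Icc_self (hmono.iterate_map_mem_Ioc h.pos hp.1 hpp hk)
    · exact hp.1.trans (hmono.iterate_map_mem_Icc hpp).1
  have hcp : 0 ≤ f.c - p := sub_nonneg.2 hp.2.le
  have hpow : (f.c - p) ^ α ≤ ((f.c - p) / f.c) ^ α :=
    Real.rpow_le_rpow hcp (le_div_self hcp f.c_mem.1 f.c_mem.2.le) h.pos.le
  have hpow1 : ((f.c - p) / f.c) ^ α ≤ 1 := Real.rpow_le_one (div_nonneg hcp f.c_mem.1.le)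
    ((div_le_one f.c_mem.1).2 (sub_le_self _ hp.1)) h.pos.le
  rw [f.std_of_lt hp.2] at hsize
  have hη := h.η_pos
  refine (Real.le_rpow_inv_iff_of_pos hcp (by positivity) h.pos).2 ?_
  nlinarith [f.u_mem.2]

theorem add_criticalRadius_le (hmono : f.IsMonotoneType a b p q) (h : f.HasExpandingPlus c₀ η)
    (hp : 0 ≤ p) (hcp : f.c - p ≤ η / 2) (hx : x ∈ Ico p f.c) {k : ℕ} (hk : 1 ≤ k) (hka : k ≤ a) :
    f.c + criticalRadius α c₀ η ≤ f.map^[k] x := by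
  obtain ⟨k, rfl⟩ := Nat.exists_eq_add_of_le' hk
  exact h.add_criticalRadius_le_iterate (fun k hk => hmono.iterate_map_mem_Ioc h.pos hp hx hk)
    (by linarith [(hmono.iterate_map_mem_Icc hx).1]) hka

theorem criticalRadius_sub_le_volume_rightGap (hmono : f.IsMonotoneType a b p q)
    (h : f.HasExpandingPlus c₀ η) (hp : p ∈ Ico 0 f.c) (hcp : f.c - p ≤ η / 2) (hq : f.c < q) :
    criticalRadius α c₀ η - (q - f.c) ≤ volume.real (f.rightGap a b p q) := by
  have hfar (x : ℝ) (hx : x ∈ Ico p f.c) (k : ℕ) :=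
    hmono.add_criticalRadius_le h hp.1 hcp hx (k := k)
  have hle : f.c + criticalRadius α c₀ η ≤ 1 :=
    (hfar p (left_mem_Ico.2 hp.2) 1 le_rfl hmono.1).trans
      (hmono.iterate_map_mem_Ioc h.pos hp.1 (left_mem_Ico.2 hp.2) hmono.1).2
  have hmeas := measureReal_mono (μ := volume) (hmono.Ioo_subset_rightGap hq hle hfar)
    (Metric.isBounded_Icc q 1 |>.subset fun x hx => ⟨hx.1.le, hx.2.1⟩).measure_lt_top.ne
  refine le_trans ?_ hmeas
  rw [Real.volume_real_Ioo]
  exact le_max_of_le_left (by linarith)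

theorem criticalRadius_sub_le_volume_leftGap (hmono : f.IsMonotoneType a b p q)
    (h : f.reflect.HasExpandingPlus c₀ η) (hq : q ∈ Ioc f.c 1) (hcq : q - f.c ≤ η / 2)
    (hp : p < f.c) :
    criticalRadius α c₀ η - (f.c - p) ≤ volume.real (f.leftGap a b p q) := by
  have hq' : 1 - q ∈ Ico 0 f.reflect.c := ⟨sub_nonneg.2 hq.2, sub_lt_sub_left hq.1 1⟩
  have hfar (x : ℝ) (hx : x ∈ Ioc f.c q) (k : ℕ) (hk : 1 ≤ k) (hkb : k ≤ b) :
      f.map^[k] x ≤ f.c - criticalRadius α c₀ η := by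
    have hreflect := hmono.reflect.add_criticalRadius_le h hq'.1
      (by linarith [f.reflect_c])
      (x := 1 - x) ⟨sub_le_sub_left hx.2 1, sub_lt_sub_left hx.1 1⟩ hk hkb
    rw [f.reflect_iterate_one_sub fun j hj => hmono.iterate_ne_of_gt hx (hj.le.trans hkb)]
      at hreflect
    linarith [f.reflect_c]
  have hle : 0 ≤ f.c - criticalRadius α c₀ η :=
    (f.iterate_mem_Icc h.pos ⟨f.c_mem.1.le.trans hq.1.le, hq.2⟩ 1).1.trans
      (hfar q (right_mem_Ioc.2 hq.1) 1 le_rfl hmono.2.1)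
  have hmeas := measureReal_mono (μ := volume) (hmono.Ioo_subset_leftGap hp hle hfar)
    (Metric.isBounded_Icc 0 p |>.subset fun x hx => ⟨hx.1, hx.2.1.le⟩).measure_lt_top.ne
  refine le_trans ?_ hmeas
  rw [Real.volume_real_Ioo]
  exact le_max_of_le_left (by linarith)

end IsMonotoneType

theorem reflect_c_sub_map_c (hα : 0 < α) :
    f.reflect.c - f.reflect.map f.reflect.c = f.phiMinus.toFun f.u - f.c := by
  have hmap : f.reflect.map f.reflect.c = 1 - f.phiMinus.toFun f.u :=
    (f.reflect.map_c_eq hα).trans (f.phiMinus.reflect_toFun_one_sub f.u)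
  rw [hmap, reflect_c]
  ring

theorem reflect_phiMinus_u_sub_c (hα : 0 < α) :
    f.reflect.phiMinus.toFun f.reflect.u - f.reflect.c = f.c - f.map f.c := by
  have hvalue : f.reflect.phiMinus.toFun f.reflect.u = 1 - f.phiPlus.toFun (1 - f.v) :=
    f.phiPlus.reflect_toFun f.v
  rw [hvalue, f.map_c_eq hα, reflect_c]
  ring

theorem map_le_phiMinus_u (hα : 0 < α) {x : ℝ} (hx : x ∈ Ico 0 f.c) :
    f.map x ≤ f.phiMinus.toFun f.u := by
  rw [f.map_of_lt hx.2]
  refine f.phiMinus.monotoneOn (f.std_mem_Icc_of_mem_Ico hα hx) f.u_mem ?_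
  rw [f.std_of_lt hx.2]
  exact mul_le_of_le_one_right f.u_mem.1 (sub_le_self 1 (Real.rpow_nonneg
    (div_nonneg (sub_nonneg.2 hx.2.le) f.c_mem.1.le) α))

namespace IsMonotoneType

theorem c_lt_phiMinus_u (hmono : f.IsMonotoneType a b p q) (hα : 0 < α) (hp : p ∈ Ico 0 f.c) :
    f.c < f.phiMinus.toFun f.u :=
  ((hmono.2.2.1 p (left_mem_Ico.2 hp.2)).2 1 le_rfl hmono.1).trans_le (map_le_phiMinus_u hα hp)

theorem c_sub_map_c_le (hmono : f.IsMonotoneType a b p q) (hα : 1 < α)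
    (hclose : f.CloseToStandard ((α - 1) / (2 * α))) (ha : 2 ≤ a) (hp : p ∈ Ico 0 f.c)
    (hc₀ : 0 < c₀) (hc : c₀ ≤ 1 - f.c) :
    f.c - f.map f.c ≤ 2 * ((f.phiMinus.toFun f.u - f.c) / c₀) ^ α := by
  have hα0 : 0 < α := zero_lt_one.trans hα
  have hright := hmono.iterate_map_mem_Ioc hα0 hp.1 (left_mem_Ico.2 hp.2) (k := 0) (by omega)
  have hagain := hmono.iterate_map_mem_Ioc hα0 hp.1 (left_mem_Ico.2 hp.2) (k := 1) (by omega)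
  have hbase : 0 ≤ (f.map p - f.c) / (1 - f.c) :=
    div_nonneg (sub_nonneg.2 hright.1.le) (hc₀.le.trans hc)
  calc f.c - f.map f.c ≤ f.map (f.map p) - f.map f.c := sub_le_sub_right hagain.1.le _
    _ ≤ 2 * ((f.map p - f.c) / (1 - f.c)) ^ α :=
        map_sub_map_c_le hα0 hclose.2 (closeness_le_half hα) (Ioc_subset_Icc_self hright)
    _ ≤ 2 * ((f.phiMinus.toFun f.u - f.c) / c₀) ^ α := by
        have hnonneg := sub_nonneg.2 (hmono.c_lt_phiMinus_u hα0 hp).le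
        gcongr
        exact map_le_phiMinus_u hα0 hp

theorem hasExpandingPlus (hmono : f.IsMonotoneType a b p q) (hα : 1 < α)
    (hclose : f.CloseToStandard ((α - 1) / (2 * α))) (ha : 2 ≤ a) (hb : 2 ≤ b) (hp : p ∈ Ico 0 f.c)
    (hq : q ∈ Ioc f.c 1) (hc₀ : 0 < c₀) (hc : f.c ∈ Icc c₀ (1 - c₀)) :
    f.HasExpandingPlus c₀ (criticalMargin α c₀) := by
  have hα0 : 0 < α := zero_lt_one.trans hα
  have hq' : 1 - q ∈ Ico 0 f.reflect.c := ⟨sub_nonneg.2 hq.2, sub_lt_sub_left hq.1 1⟩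
  have hle := hmono.c_sub_map_c_le hα hclose ha hp hc₀ (by linarith [hc.2])
  have hle' := hmono.reflect.c_sub_map_c_le hα hclose.reflect hb hq' hc₀
    (by linarith [hc.1, f.reflect_c])
  rw [reflect_phiMinus_u_sub_c hα0, reflect_c_sub_map_c hα0] at hle'
  have hpos := sub_pos.2 (hmono.c_lt_phiMinus_u hα0 hp)
  have hpos' := sub_pos.2 (hmono.reflect.c_lt_phiMinus_u hα0 hq')
  rw [reflect_phiMinus_u_sub_c hα0] at hpos'
  exact ⟨hα, hclose, hc₀, by linarith [hc.2], criticalMargin_pos hc₀,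
    le_sub_comm.1 (criticalMargin_le_of_le_of_le hα hc₀ hpos' hpos hle hle')⟩

end IsMonotoneType

theorem HasInducedMinus.closeToId {φ : LorenzDiffeo} (hφ : f.HasInducedMinus a p q φ)
    (h : f.HasExpandingPlus c₀ η) (hpq : p < q) (hp : f.c - p ≤ η / 2) {θ : ℝ}
    (ha : 2 * (1 + η)⁻¹ ^ a ≤ θ) (hqp : q - p ≤ 2 * θ)
    (hθ : (1 + 2 * distortionBound α c₀ η) * θ ≤ 1 / 4) :
    φ.CloseToId (6 * ((1 + 2 * distortionBound α c₀ η) * θ)) := by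
  refine φ.closeToId_of_abs_nonlinearity_le hθ fun y hy =>
    (hφ.abs_nonlinearity_le h hpq hp hy).trans ?_
  have hK := h.distortionBound_nonneg
  have hD := (φ.deriv_pos y hy).le
  have hθ0 : 0 ≤ θ := by linarith
  calc 2 * (1 + η)⁻¹ ^ a + distortionBound α c₀ η * ((q - p) * derivWithin φ.toFun (Icc 0 1) y)
      ≤ θ + distortionBound α c₀ η * (2 * θ * derivWithin φ.toFun (Icc 0 1) y) := by gcongr
    _ ≤ (1 + 2 * distortionBound α c₀ η) * θ * (1 + derivWithin φ.toFun (Icc 0 1) y) := by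
        nlinarith [mul_nonneg hK hθ0, mul_nonneg hθ0 hD]

theorem eventually_two_mul_pow_le (hα : 0 < α) (hη : 0 < η) {θ : ℝ} (hθ : 0 < θ) :
    ∀ᶠ n : ℕ in atTop, 2 * (1 + η)⁻¹ ^ n ≤ θ ∧ (2 * (1 + η)⁻¹ ^ n) ^ α⁻¹ ≤ θ := by
  have hpow : Tendsto (fun n : ℕ => 2 * (1 + η)⁻¹ ^ n) atTop (𝓝 0) := by
    have hrate : (1 + η)⁻¹ < 1 := inv_lt_one_of_one_lt₀ (by linarith)
    simpa using (tendsto_pow_atTop_nhds_zero_of_lt_one (by positivity) hrate).const_mul 2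
  have hroot : Tendsto (fun n : ℕ => (2 * (1 + η)⁻¹ ^ n) ^ α⁻¹) atTop (𝓝 0) := by
    simpa [Real.zero_rpow (inv_pos.2 hα).ne'] using
      hpow.rpow_const (Or.inr (inv_pos.2 hα).le)
  exact (hpow.eventually_le_const hθ).and (hroot.eventually_le_const hθ)

/-- A tolerance `θ` for the size of the return interval and for the contraction towards the fixed
points which makes all the estimates for the return map hold with the precision `ε`. -/
structure IsTolerance (α c₀ η ε θ : ℝ) : Prop where
  pos : 0 < θ
  le_half_margin : θ ≤ η / 2
  le_half_radius : θ ≤ criticalRadius α c₀ η / 2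
  four_mul_le : 4 * θ ≤ ε * criticalRadius α c₀ η
  distortion_le : (1 + 2 * distortionBound α c₀ η) * θ ≤ 1 / 4
  six_mul_distortion_le : 6 * ((1 + 2 * distortionBound α c₀ η) * θ) ≤ ε

theorem exists_isTolerance {ε : ℝ} (hc₀ : 0 < c₀) (hη : 0 < η) (hε : 0 < ε) :
    ∃ θ, IsTolerance α c₀ η ε θ := by
  have hsmall (A : ℝ) {B : ℝ} (hB : 0 < B) : ∀ᶠ θ in 𝓝[>] 0, A * θ ≤ B := by
    have hlim : Tendsto (fun θ => A * θ) (𝓝 0) (𝓝 0) := by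
      simpa using (continuous_const_mul A).tendsto 0
    exact (hlim.mono_left nhdsWithin_le_nhds).eventually_le_const hB
  have hr := criticalRadius_pos (α := α) hc₀ hη
  obtain ⟨θ, hθ⟩ := (eventually_mem_nhdsWithin.and <| (hsmall 1 (half_pos hη)).and <|
    (hsmall 1 (half_pos hr)).and <| (hsmall 4 (mul_pos hε hr)).and <|
    (hsmall (1 + 2 * distortionBound α c₀ η) (B := 1 / 4) (by norm_num)).and
    (hsmall (6 * (1 + 2 * distortionBound α c₀ η)) hε)).exists
  rw [one_mul, mul_assoc] at hθ
  obtain ⟨hpos, hη, hr, hε, h4, h6⟩ := hθ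
  exact ⟨θ, hpos, hη, hr, hε, h4, h6⟩

theorem IsMonotoneType.renormalization_estimates {g : LorenzMap α}
    (hmono : f.IsMonotoneType a b p q) (hind : f.HasInducedParts a b p q g)
    (h : f.HasExpandingPlus c₀ η) (h' : f.reflect.HasExpandingPlus c₀ η) (hp : p ∈ Ico 0 f.c)
    (hq : q ∈ Ioc f.c 1) {ε θ : ℝ} (hθ : IsTolerance α c₀ η ε θ)
    (ha : 2 * (1 + η)⁻¹ ^ a ≤ θ ∧ (2 * (1 + η)⁻¹ ^ a) ^ α⁻¹ ≤ θ)
    (hb : 2 * (1 + η)⁻¹ ^ b ≤ θ ∧ (2 * (1 + η)⁻¹ ^ b) ^ α⁻¹ ≤ θ) :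
    0 < volume.real (f.leftGap a b p q) ∧ 0 < volume.real (f.rightGap a b p q) ∧
      max ((q - p) / volume.real (f.leftGap a b p q))
        ((q - p) / volume.real (f.rightGap a b p q)) ≤ ε ∧
      g.CloseToStandard ε := by
  have hq' : 1 - q ∈ Ico 0 f.reflect.c := ⟨sub_nonneg.2 hq.2, sub_lt_sub_left hq.1 1⟩
  have hcp : f.c - p ≤ θ := (hmono.c_sub_le_rpow h hp).trans ha.2
  have hcq' : f.reflect.c - (1 - q) ≤ θ := (hmono.reflect.c_sub_le_rpow h' hq').trans hb.2
  have hcq : q - f.c ≤ θ := by linarith [f.reflect_c]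
  have hr := criticalRadius_pos (α := α) h.c₀_pos h.η_pos
  have hleft : criticalRadius α c₀ η / 2 ≤ volume.real (f.leftGap a b p q) := by
    linarith [hmono.criticalRadius_sub_le_volume_leftGap h' hq
      (hcq.trans hθ.le_half_margin) hp.2, hθ.le_half_radius]
  have hright : criticalRadius α c₀ η / 2 ≤ volume.real (f.rightGap a b p q) := by
    linarith [hmono.criticalRadius_sub_le_volume_rightGap h hp
      (hcp.trans hθ.le_half_margin) hq.1, hθ.le_half_radius]
  have hε : 0 ≤ ε := nonneg_of_mul_nonneg_left (by linarith [hθ.four_mul_le, hθ.pos]) hr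
  have hratio {V : ℝ} (hV : criticalRadius α c₀ η / 2 ≤ V) : (q - p) / V ≤ ε := by
    rw [div_le_iff₀ (by linarith)]
    linarith [mul_le_mul_of_nonneg_left hV hε, hθ.four_mul_le]
  have hminus : g.phiMinus.CloseToId ε :=
    (hind.hasInducedMinus.closeToId h (hp.2.trans hq.1) (hcp.trans hθ.le_half_margin) ha.1
      (by linarith) hθ.distortion_le).mono hθ.six_mul_distortion_le
  have hplus : g.phiPlus.reflect.CloseToId ε :=
    (hind.hasInducedMinus_reflect.closeToId h' (by linarith [hp.2, hq.1])
      (hcq'.trans hθ.le_half_margin) hb.1 (by linarith) hθ.distortion_le).mono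
      hθ.six_mul_distortion_le
  exact ⟨by linarith, by linarith, max_le (hratio hleft) (hratio hright), hminus,
    g.phiPlus.reflect_reflect ▸ hplus.reflect⟩

theorem IsFamily.exists_pos_forall_mem_Icc {U : Set (ℝ × ℝ)} {F : ℝ × ℝ → LorenzMap α}
    (h : IsFamily U F) : ∃ c₀ > 0, ∀ l ∈ U, (F l).c ∈ Icc c₀ (1 - c₀) := by
  have hdist : ContinuousOn (fun l => min (F l).c (1 - (F l).c)) U :=
    h.continuous_c.inf (continuousOn_const.sub h.continuous_c)
  obtain ⟨c₀, hpos, hle⟩ := h.compact.exists_forall_le' hdist (a := 0) fun l _ =>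
    lt_min (F l).c_mem.1 (sub_pos.2 (F l).c_mem.2)
  exact ⟨c₀, hpos, fun l hl =>
    ⟨(hle l hl).trans (min_le_left _ _), le_sub_comm.1 ((hle l hl).trans (min_le_right _ _))⟩⟩

theorem IsIsland.subset {U D : Set (ℝ × ℝ)} {F : ℝ × ℝ → LorenzMap α}
    (h : IsIsland U F a b D) (hU : IsClosed U) : D ⊆ U := by
  obtain ⟨l, -, rfl⟩ := h
  exact closure_minimal ((connectedComponentIn_subset _ _).trans
    (interior_subset.trans fun _ hx => hx.1)) hU

end LorenzMap

theorem mainTheorem7_general {α c₀ ε : ℝ} (hα : 1 < α) (hc₀ : 0 < c₀) (hε : 0 < ε) :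
    ∃ N : ℕ, 1 ≤ N ∧ ∀ a b : ℕ, N ≤ a → N ≤ b → ∀ f : LorenzMap α,
      f.c ∈ Icc c₀ (1 - c₀) → f.CloseToStandard ((α - 1) / (2 * α)) →
      ∀ (p q : ℝ) (g : LorenzMap α), p ∈ Ico 0 f.c → q ∈ Ioc f.c 1 →
        f.IsMonotoneType a b p q → f.HasInducedParts a b p q g →
          0 < volume.real (f.leftGap a b p q) ∧
          0 < volume.real (f.rightGap a b p q) ∧
          max ((q - p) / volume.real (f.leftGap a b p q))
            ((q - p) / volume.real (f.rightGap a b p q)) ≤ ε ∧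
          g.CloseToStandard ε := by
  have hη := criticalMargin_pos (α := α) hc₀
  obtain ⟨θ, hθ⟩ := LorenzMap.exists_isTolerance (α := α) hc₀ hη hε
  obtain ⟨N, hN⟩ := eventually_atTop.1
    (LorenzMap.eventually_two_mul_pow_le (zero_lt_one.trans hα) hη hθ.pos)
  refine ⟨max N 2, le_max_of_le_right one_le_two,
    fun a b ha hb f hc hclose p q g hp hq hmono hind => ?_⟩
  obtain ⟨hNa, ha⟩ := max_le_iff.1 ha
  obtain ⟨hNb, hb⟩ := max_le_iff.1 hb
  have hplus := hmono.hasExpandingPlus hα hclose ha hb hp hq hc₀ hc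
  have hminus := hmono.reflect.hasExpandingPlus hα hclose.reflect hb ha
    ⟨sub_nonneg.2 hq.2, sub_lt_sub_left hq.1 1⟩ ⟨sub_lt_sub_left hp.2 1, sub_le_self 1 hp.1⟩ hc₀
    ⟨le_sub_comm.1 hc.2, sub_le_sub_left hc.1 1⟩
  exact hmono.renormalization_estimates hind hplus hminus hp hq hθ (hN a hNa) (hN b hNb)

theorem mainTheorem7 (α : ℝ) (hα : 1 < α) :
    ∃ δ : ℝ, 0 < δ ∧ ∀ (U : Set (ℝ × ℝ)) (F : ℝ × ℝ → LorenzMap α),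
      LorenzMap.IsFullFamily U F → LorenzMap.IsAnalyticFamily U F →
      (∀ l ∈ U, (F l).CloseToStandard δ) →
      ∀ ε : ℝ, 0 < ε → ∃ N : ℕ, 1 ≤ N ∧ ∀ a b : ℕ, N ≤ a → N ≤ b →
        ∀ D : Set (ℝ × ℝ), LorenzMap.IsFullIsland U F a b D → ∀ l ∈ D,
          ∃ (p q : ℝ) (g : LorenzMap α), (F l).IsRenormalization a b p q g ∧
            0 < volume.real ((F l).leftGap a b p q) ∧
            0 < volume.real ((F l).rightGap a b p q) ∧
            max ((q - p) / volume.real ((F l).leftGap a b p q))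
              ((q - p) / volume.real ((F l).rightGap a b p q)) ≤ ε ∧
            g.CloseToStandard ε := by
  refine ⟨(α - 1) / (2 * α), div_pos (by linarith) (by linarith), ?_⟩
  intro U F hfull _ hclose ε hε
  obtain ⟨c₀, hc₀, hc⟩ := hfull.1.exists_pos_forall_mem_Icc
  obtain ⟨N, hN1, hN⟩ := mainTheorem7_general hα hc₀ hε
  refine ⟨N, hN1, fun a b ha hb D ⟨hisland, R, hR, _⟩ l hl => ?_⟩
  have hlU := hisland.subset hfull.1.compact.isClosed hl
  obtain ⟨p, q, hren⟩ := hR l hl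
  obtain ⟨⟨⟨hp, hpc, hcq, hq, -⟩, -⟩, hmono, -, hind⟩ := id hren
  exact ⟨p, q, R l, hren, hN a b ha hb (F l) (hc l hlU) (hclose l hlU) p q (R l)
    ⟨hp, hpc⟩ ⟨hcq, hq⟩ hmono hind⟩
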